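/- Let $\mathbb X\subset\mathbb R^n$ be a compact convex set, $c\in\mathbb R^n$, and let $\mathcal D$ be an arbitrary (possibly infinite-dimensional) metric space with a Borel probability measure $\mathbb P$. Let $f:\mathbb X\times\mathcal D\to\mathbb R$ be measurable, convex in $x$ for each $d\in\mathcal D$, and bounded in $d$ for each $x\in\mathbb X$. Put $$J^\star_{\mathrm{RCP}}=\inf\{c^\top x:\ x\in\mathbb X,\ f(x,d)\le 0\ \ \forall d\in\mathcal D\},\qquad J^\star_N(d_1,\dots,d_N)=\inf\{c^\top x:\ x\in\mathbb X,\ f(x,d_i)\le 0,\ i=1,\dots,N\}.$$ Assume that for every $N$ there is a measurable map $\mathcal D^N\to\mathbb X$ (with $\mathcal D^N$ carrying the product $\sigma$-algebra) that assigns to each $(d_1,\dots,d_N)$ an optimizer of the second program (the scenario program). Assume that $x_0\in\mathbb X$ is a Slater point, i.e. $\sup_{d\in\mathcal D} f(x_0,d)<0$, and put $$L_{\mathrm{SP}}=\frac{\min_{x\in\mathbb X}c^\top x-c^\top x_0}{\sup_{d\in\mathcal D}f(x_0,d)}.$$ For $x\in\mathbb X$ and $\delta\ge 0$ let $p(x,\delta)=\mathbb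 P\big[\sup_{v\in\mathcal D}f(x,v)-\delta<f(x,d)\big]$. Let $h:[0,1]\to[0,\infty]$ be a uniform level-set bound, i.e. $$h(\varepsilon)\ \ge\ \sup\Big\{\delta\ge 0:\ \inf_{x\in\mathbb X}p(x,\delta)\le\varepsilon\Big\}\quad\text{in }[0,\infty],\quad\text{for all }\varepsilon\in[0,1].$$ For $\varepsilon,\beta\in[0,1]$ let $N(\varepsilon,\beta)$ be the least natural number $N$ with $\sum_{i=0}^{n-1}\binom Ni\varepsilon^i(1-\varepsilon)^{N-i}\le\beta$, and $N(\varepsilon,\beta)=\infty$ if there is none. Then for all $\varepsilon,\beta\in[0,1]$ and all natural numbers $N\ge N(\varepsilon,\beta)$, $$\mathbb P^N\Big[J^\star_{\mathrm{RCP}}-J^\star_N\in[0,I(\varepsilon)]\Big]\ \ge\ 1-\beta,\qquad I(\varepsilon)=\min\Big\{L_{\mathrm{SP}}\,h(\varepsilon),\ \max_{x\in\mathbb X}c^\top x-\min_{x\in\mathbb X}c^\top x\Big\},$$ where $\mathbb P^N$ is the $N$-fold product measure and $0\cdot\infty=0$. -/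

import Mathlib

open MeasureTheory
open scoped ENNReal NNReal

noncomputable section

namespace ScenarioProgram

/-- The optimal value of the program: minimize `cᵀ x` over the feasible set `K`. -/
def optVal {n : ℕ} (c : EuclideanSpace ℝ (Fin n)) (K : Set (EuclideanSpace ℝ (Fin n))) : ℝ :=
  sInf ((fun x => inner ℝ c x) '' K)

/-- `x` is an optimizer of the program: minimize `cᵀ x` over the feasible set `K`. -/
def IsOptimizer {n : ℕ} (c : EuclideanSpace ℝ (Fin n)) (K : Set (EuclideanSpace ℝ (Fin n)))
    (x : EuclideanSpace ℝ (Fin n)) : Prop :=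
  x ∈ K ∧ ∀ y ∈ K, (inner ℝ c x : ℝ) ≤ inner ℝ c y

/-- The feasible set of the robust convex program. -/
def rcpFeasible {n : ℕ} {D : Type*} (X : Set (EuclideanSpace ℝ (Fin n)))
    (f : EuclideanSpace ℝ (Fin n) → D → ℝ) : Set (EuclideanSpace ℝ (Fin n)) :=
  {x | x ∈ X ∧ ∀ d : D, f x d ≤ 0}

/-- The feasible set of the scenario program for the scenarios `d 0, …, d (N - 1)`. -/
def scpFeasible {n N : ℕ} {D : Type*} (X : Set (EuclideanSpace ℝ (Fin n)))
    (f : EuclideanSpace ℝ (Fin n) → D → ℝ) (d : Fin N → D) : Set (EuclideanSpace ℝ (Fin n)) :=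
  {x | x ∈ X ∧ ∀ i : Fin N, f x (d i) ≤ 0}

/-- The number `N(ε, β)`: the least `N` with `∑_{i<n} (N choose i) ε^i (1-ε)^(N-i) ≤ β`,
and `∞` if there is no such `N`. -/
def sampleSize (n : ℕ) (ε β : ℝ) : ℕ∞ :=
  ⨅ N ∈ {N : ℕ | ∑ i ∈ Finset.range n, (N.choose i : ℝ) * ε ^ i * (1 - ε) ^ (N - i) ≤ β}, (N : ℕ∞)

/-- The tail probability of the worst-case violation
`p(x, δ) = P[sup_v f(x, v) - δ < f(x, d)]`. -/
def tailProb {n : ℕ} {D : Type*} [MeasurableSpace D] (P : Measure D)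
    (f : EuclideanSpace ℝ (Fin n) → D → ℝ) (x : EuclideanSpace ℝ (Fin n)) (δ : ℝ≥0) : ℝ≥0∞ :=
  P {d | (⨆ v, f x v) - δ < f x d}

/-- `h` is a uniform level-set bound. The supremum is taken in `[0, ∞]`, and `h` may take the
value `∞`: at `ε = 1` the set of all `δ` is `[0, ∞)`, so no finite value can bound it. -/
def IsULB {n : ℕ} {D : Type*} [MeasurableSpace D] (P : Measure D)
    (X : Set (EuclideanSpace ℝ (Fin n))) (f : EuclideanSpace ℝ (Fin n) → D → ℝ)
    (h : Set.Icc (0 : ℝ) 1 → ℝ≥0∞) : Prop :=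
  ∀ ε : Set.Icc (0 : ℝ) 1,
    (⨆ δ ∈ {δ : ℝ≥0 | (⨅ x ∈ X, tailProb P f x δ) ≤ ENNReal.ofReal (ε : ℝ)}, (δ : ℝ≥0∞)) ≤ h ε

/-- The constant `L_SP = (min_X cᵀ x - cᵀ x₀) / sup_d f(x₀, d)` of a Slater point `x₀`. -/
def slaterConst {n : ℕ} {D : Type*} (c : EuclideanSpace ℝ (Fin n))
    (X : Set (EuclideanSpace ℝ (Fin n))) (f : EuclideanSpace ℝ (Fin n) → D → ℝ)
    (x₀ : EuclideanSpace ℝ (Fin n)) : ℝ :=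
  (sInf ((fun x => inner ℝ c x) '' X) - inner ℝ c x₀) / ⨆ d, f x₀ d

/-- The length `min {L * η, max_X cᵀ x - min_X cᵀ x}` of the confidence interval, for
`η = h(ε)` in `[0, ∞]`. The minimum is taken in `[0, ∞]` (with `0 * ∞ = 0`); it is always finite,
hence read as a real number. -/
def intervalLength {n : ℕ} (c : EuclideanSpace ℝ (Fin n))
    (X : Set (EuclideanSpace ℝ (Fin n))) (L : ℝ) (η : ℝ≥0∞) : ℝ :=
  (min (ENNReal.ofReal L * η)
    (ENNReal.ofReal (sSup ((fun x => inner ℝ c x) '' X) -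
      sInf ((fun x => inner ℝ c x) '' X)))).toReal

end ScenarioProgram

end

/-! Two facts combine. The first is deterministic. Put `s = sup f(x, ·)`. If `s > 0`, moving `x`
towards the Slater point restores feasibility at cost at most `L_SP * s` (`optVal_rcp_le_add`); and
if `x` is violated with probability at most `ε`, then `δ = s` is admissible in the level-set bound,
so `s ≤ h(ε)`. Hence a scenario optimizer lying more than `L_SP * h(ε)` below the robust optimum is
violated with probability greater than `ε`. The second fact (`pi_le_of_exists_feasible_lt`) bounds
the probability of that event by the binomial tail.

For the second fact, suppose that minimizers are unique and that almost surely no scenario outside a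
subset is active at the minimizer for this subset. By Helly's theorem exactly one set of at most `n`
scenarios is then a basis: all its members are essential, and it determines the minimizer
(`existsUnique_basis`). Let `ν_k` be the law of the satisfaction probability `t` of the minimizer
for `k` scenarios, on the event that all `k` are essential. Given the scenarios of such a `k`-set,
it is a basis among `M` scenarios with probability `t ^ (M - k)`. Summing over all sets gives `∑_k
(M choose k) ∫ t ^ (M - k) dν_k = 1` for every `M`, that is, `∑_k ∫ Λ^(k) / k! dν_k = Λ(1)` for
every polynomial `Λ`.

The probability to be bounded is at most the same sum with `M = N` and the integrals restricted to
`t < b = 1 - ε`. By linear programming duality it is at most `Λ(1)` whenever the derivatives of `Λ`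
of order at most `n` are nonnegative on `[0, 1]` and dominate those of `t ^ N` on `[0, b]`
(`sum_choose_mul_integral_le`). The ideal `Λ` is `t ^ N` continued beyond `b` by its Taylor
polynomial of degree less than `n`, whose value at `1` is the binomial tail. Approximating its
`n`-th derivative by Weierstrass makes it a polynomial.

A general program is reduced to this case by shrinking `X` towards a Slater point (for continuity
and slack), adding `τ‖x‖²` to the objective (for uniqueness) and a random margin to each constraint
(for nondegeneracy). The price is an arbitrarily small loss in the objective, removed by a limit at
the end. -/

namespace ScenarioProgram

/-! ### Polynomial majorants and the dual bound on moments -/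

open Polynomial in
/-- If the first `n` derivatives of a polynomial are nonnegative at the left end of an interval and
the `n`-th derivative is nonnegative on it, then all these derivatives are nonnegative on it. -/
theorem iterate_derivative_nonneg_of_left {a e : ℝ} (n : ℕ) (A : ℝ[X])
    (h0 : ∀ k < n, 0 ≤ (derivative^[k] A).eval a)
    (hn : ∀ t ∈ Set.Icc a e, 0 ≤ (derivative^[n] A).eval t) :
    ∀ k ≤ n, ∀ t ∈ Set.Icc a e, 0 ≤ (derivative^[k] A).eval t := by
  induction n generalizing A with
  | zero =>
    intro k hk
    obtain rfl : k = 0 := by omega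
    exact hn
  | succ n ih =>
    have hd : ∀ k ≤ n, ∀ t ∈ Set.Icc a e, 0 ≤ (derivative^[k] (derivative A)).eval t := by
      refine ih (derivative A) (fun k hk => ?_) hn
      exact h0 (k + 1) (by omega)
    intro k hk t ht
    rcases k with _ | k
    · have hmono : MonotoneOn (fun x => A.eval x) (Set.Icc a e) := by
        refine monotoneOn_of_deriv_nonneg (convex_Icc a e) A.continuous.continuousOn
          A.differentiable.differentiableOn (fun x hx => ?_)
        rw [Polynomial.deriv]
        exact hd 0 (Nat.zero_le _) x (interior_subset hx)
      exact (h0 0 (Nat.succ_pos _)).trans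
        (hmono (Set.left_mem_Icc.2 (ht.1.trans ht.2)) ht ht.1)
    · exact hd k (by omega) t ht

open Polynomial in
theorem exists_derivative_eq (q : ℝ[X]) : ∃ A : ℝ[X], derivative A = q ∧ A.eval 0 = 0 := by
  induction q using Polynomial.induction_on' with
  | add p q hp hq =>
    obtain ⟨A, hA, hA0⟩ := hp
    obtain ⟨B, hB, hB0⟩ := hq
    exact ⟨A + B, by simp [hA, hB], by simp [hA0, hB0]⟩
  | monomial k a =>
    refine ⟨monomial (k + 1) (a / (k + 1)), ?_, by simp⟩
    rw [derivative_monomial]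
    have : ((k : ℝ) + 1) ≠ 0 := by positivity
    simp [this]

open Polynomial in
theorem exists_iterate_derivative_eq (n : ℕ) (q : ℝ[X]) :
    ∃ A : ℝ[X], derivative^[n] A = q ∧ ∀ k < n, (derivative^[k] A).eval 0 = 0 := by
  induction n with
  | zero => exact ⟨q, rfl, by simp⟩
  | succ n ih =>
    obtain ⟨B, hB, hB0⟩ := ih
    obtain ⟨A, hA, hA0⟩ := exists_derivative_eq B
    refine ⟨A, by rw [Function.iterate_succ_apply, hA, hB], fun k hk => ?_⟩
    rcases k with _ | k
    · simpa using hA0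
    · rw [Function.iterate_succ_apply, hA]
      exact hB0 k (by omega)

open Polynomial in
theorem eval_iterate_derivative_X_pow (N k : ℕ) (t : ℝ) :
    (derivative^[k] (X ^ N : ℝ[X])).eval t = (N.descFactorial k : ℝ) * t ^ (N - k) := by
  simp [Polynomial.iterate_derivative_X_pow_eq_natCast_mul]

open Polynomial in
/-- The Taylor polynomial of degree less than `n` of `X ^ N` at `b`. -/
noncomputable def powTaylor (n N : ℕ) (b : ℝ) : ℝ[X] :=
  ∑ i ∈ Finset.range n, C ((N.choose i : ℝ) * b ^ (N - i)) * (X - C b) ^ i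

open Polynomial in
theorem iterate_derivative_powTaylor_eq_zero (n N : ℕ) (b : ℝ) :
    derivative^[n] (powTaylor n N b) = 0 := by
  rw [powTaylor, Polynomial.iterate_derivative_sum]
  refine Finset.sum_eq_zero fun i hi => ?_
  rw [Polynomial.iterate_derivative_C_mul, Polynomial.iterate_derivative_X_sub_pow,
    Nat.descFactorial_of_lt (Finset.mem_range.1 hi)]
  simp

open Polynomial in
theorem eval_iterate_derivative_powTaylor {n N k : ℕ} (hk : k < n) (b : ℝ) :
    (derivative^[k] (powTaylor n N b)).eval b = (derivative^[k] (X ^ N : ℝ[X])).eval b := by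
  rw [powTaylor, Polynomial.iterate_derivative_sum, Polynomial.eval_finsetSum,
    Finset.sum_eq_single k]
  · rw [Polynomial.iterate_derivative_C_mul, Polynomial.iterate_derivative_X_sub_pow,
      eval_iterate_derivative_X_pow, Nat.descFactorial_eq_factorial_mul_choose N k,
      Nat.descFactorial_self]
    simp
    ring
  · intro i _ hik
    rw [Polynomial.iterate_derivative_C_mul, Polynomial.iterate_derivative_X_sub_pow]
    rcases lt_or_gt_of_ne hik with h | h
    · rw [Nat.descFactorial_of_lt h]; simp
    · have : i - k ≠ 0 := by omega
      simp [this]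
  · intro h
    exact absurd (Finset.mem_range.2 hk) h

-- At `t = 1` this is the lower binomial tail with success probability `1 - b`.
open Polynomial in
theorem eval_powTaylor (n N : ℕ) (b t : ℝ) :
    (powTaylor n N b).eval t =
      ∑ i ∈ Finset.range n, (N.choose i : ℝ) * (t - b) ^ i * b ^ (N - i) := by
  rw [powTaylor, Polynomial.eval_finsetSum]
  refine Finset.sum_congr rfl fun i _ => ?_
  simp
  ring

open Polynomial in
/-- A polynomial `q` such that `q + r` approximates from above, on `[0, 1]`, the polynomial `r` cut
off between `b` and `b'`. -/
theorem exists_polynomial_cutoff (r : ℝ[X]) (hr : ∀ t ∈ Set.Icc (0 : ℝ) 1, 0 ≤ r.eval t)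
    {b b' η : ℝ} (hbb : b < b') (hη : 0 < η) :
    ∃ q : ℝ[X], (∀ t ∈ Set.Icc (0 : ℝ) 1, t ≤ b → 0 ≤ q.eval t) ∧
      (∀ t ∈ Set.Icc (0 : ℝ) 1, 0 ≤ q.eval t + r.eval t) ∧
      (∀ t ∈ Set.Icc (0 : ℝ) 1, q.eval t ≤ η) ∧
      (∀ t ∈ Set.Icc (0 : ℝ) 1, b' ≤ t → q.eval t + r.eval t ≤ η) := by
  -- A ramp from `0` at `b` to `1` at `b'`. The target for `q + r` is `r * (1 - σ)`; the shift by `η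
  -- / 2` below turns a two-sided error of `η / 2` into an error between `0` and `η`.
  let σ : ℝ → ℝ := fun t => max 0 (min 1 ((t - b) / (b' - b)))
  have hσ0 : ∀ t, 0 ≤ σ t := fun t => le_max_left _ _
  have hσ1 : ∀ t, σ t ≤ 1 := fun t => max_le zero_le_one (min_le_left _ _)
  have hσb : ∀ t ≤ b, σ t = 0 := fun t ht =>
    max_eq_left ((min_le_right _ _).trans
      (div_nonpos_of_nonpos_of_nonneg (by linarith) (by linarith)))
  have hσb' : ∀ t, b' ≤ t → σ t = 1 := fun t ht => by
    have : 1 ≤ (t - b) / (b' - b) := by rw [le_div_iff₀ (by linarith)]; linarith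
    simp only [σ, min_eq_left this]
    norm_num
  have hcont : Continuous fun t => -(r.eval t * σ t) + η / 2 := by
    have h1 : Continuous fun t => r.eval t := r.continuous
    have h2 : Continuous σ := by fun_prop
    fun_prop
  obtain ⟨q, hq⟩ := exists_polynomial_near_of_continuousOn 0 1 _ hcont.continuousOn (η / 2)
    (half_pos hη)
  have hq' : ∀ t ∈ Set.Icc (0 : ℝ) 1, -(r.eval t * σ t) ≤ q.eval t ∧
      q.eval t ≤ -(r.eval t * σ t) + η := fun t ht => by
    have := abs_lt.1 (hq t ht)
    constructor <;> linarith [this.1, this.2]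
  refine ⟨q, fun t ht htb => ?_, fun t ht => ?_, fun t ht => ?_, fun t ht htb => ?_⟩
  · have := (hq' t ht).1
    rw [hσb t htb] at this
    simpa using this
  · have := (hq' t ht).1
    nlinarith [hr t ht, hσ1 t]
  · have := (hq' t ht).2
    nlinarith [mul_nonneg (hr t ht) (hσ0 t)]
  · have := (hq' t ht).2
    rw [hσb' t htb] at this
    linarith

-- Take `Λ = X ^ N + A`, where `A` is the `n`-fold antiderivative at `0` of the cutoff polynomial
-- `q`, so that the `n`-th derivative of `Λ` is nearly that of `X ^ N` cut off between `b` and `b'`.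
-- Each inequality is one on `n`-th derivatives, integrated up from an endpoint where the lower
-- derivatives are already controlled.
open Polynomial in
theorem exists_polynomial_majorant_aux (n N : ℕ) {b b' η : ℝ} (hb : 0 ≤ b) (hbb : b < b')
    (hb' : b' ≤ 1) (hη : 0 < η) :
    ∃ Λ : ℝ[X], (∀ k ≤ n, ∀ t ∈ Set.Icc (0 : ℝ) 1, 0 ≤ (derivative^[k] Λ).eval t) ∧
      (∀ k ≤ n, ∀ t ∈ Set.Icc (0 : ℝ) b,
        (derivative^[k] (X ^ N : ℝ[X])).eval t ≤ (derivative^[k] Λ).eval t) ∧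
      Λ.eval 1 ≤ (∑ i ∈ Finset.range n, (N.choose i : ℝ) * (1 - b') ^ i * b' ^ (N - i)) + η := by
  have hQ : ∀ k t, 0 ≤ t → 0 ≤ (derivative^[k] (X ^ N : ℝ[X])).eval t := fun k t ht => by
    rw [eval_iterate_derivative_X_pow]; positivity
  obtain ⟨q, hq1, hq2, hq3, hq4⟩ := exists_polynomial_cutoff (derivative^[n] (X ^ N : ℝ[X]))
    (fun t ht => hQ n t ht.1) hbb hη
  obtain ⟨A, hAn, hA0⟩ := exists_iterate_derivative_eq n q
  have hlow : ∀ k ≤ n, ∀ t ∈ Set.Icc (0 : ℝ) b, 0 ≤ (derivative^[k] A).eval t := by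
    refine iterate_derivative_nonneg_of_left n A (fun k hk => (hA0 k hk).ge) fun t ht => ?_
    rw [hAn]
    exact hq1 t ⟨ht.1, by linarith [ht.2]⟩ ht.2
  have hadd : ∀ k, derivative^[k] (X ^ N + A) = derivative^[k] (X ^ N : ℝ[X]) + derivative^[k] A :=
    fun k => iterate_map_add derivative k _ _
  have hlow' : ∀ k ≤ n, ∀ t ∈ Set.Icc (0 : ℝ) b,
      (derivative^[k] (X ^ N : ℝ[X])).eval t ≤ (derivative^[k] (X ^ N + A)).eval t :=
    fun k hk t ht => by
      rw [hadd, eval_add]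
      linarith [hlow k hk t ht]
  have hpos : ∀ k ≤ n, ∀ t ∈ Set.Icc b 1, 0 ≤ (derivative^[k] (X ^ N + A)).eval t := by
    refine iterate_derivative_nonneg_of_left n _ (fun k hk => ?_) fun t ht => ?_
    · exact (hQ k b hb).trans (hlow' k hk.le b ⟨hb, le_rfl⟩)
    · rw [hadd, eval_add, hAn]
      linarith [hq2 t ⟨hb.trans ht.1, ht.2⟩]
  -- `η * X ^ n` absorbs the approximation error: its `n`-th derivative `η * n!` is at least `η`,
  -- yet it contributes only `η` at `1`.
  have hfac : ∀ t, η ≤ (derivative^[n] (C η * X ^ n : ℝ[X])).eval t := fun t => by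
    rw [iterate_derivative_C_mul, eval_mul, eval_iterate_derivative_X_pow, Nat.descFactorial_self]
    have : (1 : ℝ) ≤ n.factorial := by exact_mod_cast Nat.succ_le_of_lt n.factorial_pos
    simp
    nlinarith
  have hup : ∀ k ≤ n, ∀ t ∈ Set.Icc (0 : ℝ) b', 0 ≤ (derivative^[k] (C η * X ^ n - A)).eval t := by
    refine iterate_derivative_nonneg_of_left n _ (fun k hk => ?_) fun t ht => ?_
    · rw [iterate_derivative_sub, eval_sub, hA0 k hk, iterate_derivative_C_mul, eval_mul,
        eval_iterate_derivative_X_pow]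
      simp
      positivity
    · rw [iterate_derivative_sub, eval_sub, hAn]
      linarith [hfac t, hq3 t ⟨ht.1, ht.2.trans hb'⟩]
  -- Beyond `b'` compare with the Taylor polynomial: it agrees with `X ^ N` at `b'` to order `n -
  -- 1`, and its `n`-th derivative vanishes, as that of `Λ` nearly does.
  have hup' : ∀ k ≤ n, ∀ t ∈ Set.Icc b' 1,
      0 ≤ (derivative^[k] (C η * X ^ n + powTaylor n N b' - (X ^ N + A))).eval t := by
    refine iterate_derivative_nonneg_of_left n _ (fun k hk => ?_) fun t ht => ?_
    · have := hup k hk.le b' ⟨by linarith, le_rfl⟩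
      rw [iterate_derivative_sub, eval_sub] at this
      rw [iterate_derivative_sub, iterate_map_add, hadd, eval_sub, eval_add, eval_add,
        eval_iterate_derivative_powTaylor hk]
      linarith
    · rw [iterate_derivative_sub, iterate_map_add, hadd, eval_sub, eval_add, eval_add,
        iterate_derivative_powTaylor_eq_zero, hAn, eval_zero]
      linarith [hfac t, hq4 t ⟨by linarith [ht.1], ht.2⟩ ht.1]
  refine ⟨X ^ N + A, fun k hk t ht => ?_, hlow', ?_⟩
  · rcases le_total t b with h | h
    · exact (hQ k t ht.1).trans (hlow' k hk t ⟨ht.1, h⟩)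
    · exact hpos k hk t ⟨h, ht.2⟩
  · have := hup' 0 (Nat.zero_le _) 1 ⟨hb', le_rfl⟩
    simp only [Function.iterate_zero, id_eq, eval_sub, eval_add, eval_powTaylor, eval_mul, eval_C,
      eval_pow, eval_X, one_pow, mul_one] at this
    simp only [eval_add, eval_pow, eval_X, one_pow]
    linarith

open Polynomial in
/-- A polynomial that dominates, together with its first `n` derivatives, the function `t ^ N` cut
off at `b`, and whose value at `1` nearly is the lower tail of the binomial distribution. -/
theorem exists_polynomial_majorant (n N : ℕ) {b η : ℝ} (hb : 0 ≤ b) (hb1 : b < 1) (hη : 0 < η) :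
    ∃ Λ : ℝ[X], (∀ k ≤ n, ∀ t ∈ Set.Icc (0 : ℝ) 1, 0 ≤ (derivative^[k] Λ).eval t) ∧
      (∀ k ≤ n, ∀ t ∈ Set.Icc (0 : ℝ) b,
        (derivative^[k] (X ^ N : ℝ[X])).eval t ≤ (derivative^[k] Λ).eval t) ∧
      Λ.eval 1 ≤ (∑ i ∈ Finset.range n, (N.choose i : ℝ) * (1 - b) ^ i * b ^ (N - i)) + η := by
  have hcont : Continuous fun s : ℝ =>
      ∑ i ∈ Finset.range n, (N.choose i : ℝ) * (1 - s) ^ i * s ^ (N - i) := by fun_prop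
  obtain ⟨δ, hδ, hδ'⟩ := Metric.continuous_iff.1 hcont b (η / 2) (half_pos hη)
  have hm : 0 < min (δ / 2) (1 - b) := lt_min (half_pos hδ) (by linarith)
  obtain ⟨Λ, h1, h2, h3⟩ := exists_polynomial_majorant_aux n N (b := b)
    (b' := b + min (δ / 2) (1 - b)) (η := η / 2) hb (by linarith)
    (by linarith [min_le_right (δ / 2) (1 - b)]) (half_pos hη)
  refine ⟨Λ, h1, h2, ?_⟩
  have := hδ' (b + min (δ / 2) (1 - b)) (by
    rw [Real.dist_eq, add_sub_cancel_left, abs_of_pos hm]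
    linarith [min_le_left (δ / 2) (1 - b)])
  rw [Real.dist_eq] at this
  linarith [(abs_lt.1 this).2]

open Polynomial in
/-- A family of measures on `[0, 1]` with the moments of a probability distribution of basis
sizes satisfies the binomial tail bound. -/
theorem sum_choose_mul_integral_le (n : ℕ) (ν : ℕ → Measure ℝ) [∀ k, IsFiniteMeasure (ν k)]
    (hν : ∀ k, ∀ᵐ t ∂ν k, t ∈ Set.Icc (0 : ℝ) 1)
    (hmom : ∀ M : ℕ,
      ∑ k ∈ Finset.range (n + 1), (M.choose k : ℝ) * ∫ t, t ^ (M - k) ∂ν k = 1)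
    (N : ℕ) {b : ℝ} (hb : 0 ≤ b) (hb1 : b < 1) :
    ∑ k ∈ Finset.range (n + 1), (N.choose k : ℝ) * ∫ t in Set.Iio b, t ^ (N - k) ∂ν k ≤
      ∑ i ∈ Finset.range n, (N.choose i : ℝ) * (1 - b) ^ i * b ^ (N - i) := by
  have hint : ∀ (p : ℝ[X]) k, Integrable (fun t => p.eval t) (ν k) := fun p k => by
    obtain ⟨C, hC⟩ := (isCompact_Icc (a := (0 : ℝ)) (b := 1)).exists_bound_of_continuousOn
      p.continuous.continuousOn
    exact Integrable.of_bound p.continuous.aestronglyMeasurable C ((hν k).mono fun t ht => hC t ht)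
  -- The moment hypotheses are this identity for monomials, since the `k`-th Hasse derivative of `X
  -- ^ M` is `(M choose k) * X ^ (M - k)`.
  have hpoly : ∀ p : ℝ[X],
      ∑ k ∈ Finset.range (n + 1), ∫ t, (hasseDeriv k p).eval t ∂ν k = p.eval 1 := fun p => by
    induction p using Polynomial.induction_on' with
    | add p q hp hq =>
      rw [eval_add, ← hp, ← hq, ← Finset.sum_add_distrib]
      refine Finset.sum_congr rfl fun k _ => ?_
      rw [← integral_add (hint _ k) (hint _ k)]
      simp
    | monomial M a =>
      simp only [hasseDeriv_monomial, eval_monomial, one_pow, mul_one]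
      refine Eq.trans ?_ (mul_one a)
      rw [← hmom M, Finset.mul_sum]
      refine Finset.sum_congr rfl fun k _ => ?_
      rw [integral_const_mul]
      ring
  refine le_of_forall_pos_le_add fun η hη => ?_
  obtain ⟨Λ, h1, h2, h3⟩ := exists_polynomial_majorant n N hb hb1 hη
  refine le_trans ?_ h3
  rw [← hpoly Λ]
  refine Finset.sum_le_sum fun k hk => ?_
  have hkn : k ≤ n := by simpa [Nat.lt_succ_iff] using hk
  have hder : ∀ (p : ℝ[X]) t, (derivative^[k] p).eval t = k.factorial * (hasseDeriv k p).eval t :=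
    fun p t => by
      rw [← factorial_smul_hasseDeriv]; simp
  have hfac : (0 : ℝ) < k.factorial := by exact_mod_cast k.factorial_pos
  have hX : ∀ t : ℝ, (N.choose k : ℝ) * t ^ (N - k) = (hasseDeriv k (X ^ N : ℝ[X])).eval t :=
    fun t => by
      rw [← monomial_one_right_eq_X_pow, hasseDeriv_monomial, eval_monomial]
      simp
  rw [← integral_const_mul, ← integral_indicator measurableSet_Iio]
  refine integral_mono_ae ?_ (hint _ k) ?_
  · refine Integrable.indicator ?_ measurableSet_Iio
    simp only [hX]
    exact hint _ k
  · filter_upwards [hν k] with t ht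
    by_cases htb : t ∈ Set.Iio b
    · rw [Set.indicator_of_mem htb, hX]
      have := h2 k hkn t ⟨ht.1, le_of_lt htb⟩
      rw [hder, hder] at this
      exact le_of_mul_le_mul_left this hfac
    · rw [Set.indicator_of_notMem htb]
      have := h1 k hkn t ht
      rw [hder] at this
      exact nonneg_of_mul_nonneg_right this hfac

/-! ### Bases of strictly convex programs -/

/-- A family of convex programs with a strictly convex objective `φ` over a compact convex set `K`,
with a constraint `g x z ≤ 0` for each scenario `z`, and a point feasible for all scenarios. -/
structure ConvexFamily (E Z : Type*) [NormedAddCommGroup E] [NormedSpace ℝ E] where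
  K : Set E
  g : E → Z → ℝ
  φ : E → ℝ
  isCompact : IsCompact K
  convexOn_g : ∀ z, ConvexOn ℝ K (fun x => g x z)
  continuousOn_g : ∀ z, ContinuousOn (fun x => g x z) K
  strictConvexOn_φ : StrictConvexOn ℝ K φ
  continuousOn_φ : ContinuousOn φ K
  exists_feasible : ∃ x ∈ K, ∀ z, g x z ≤ 0

namespace ConvexFamily

variable {E Z ι κ : Type*} [NormedAddCommGroup E] [NormedSpace ℝ E] (p : ConvexFamily E Z)

/-- The points satisfying the constraints with indices in `I`. -/
def feas (z : ι → Z) (I : Finset ι) : Set E := {x | x ∈ p.K ∧ ∀ i ∈ I, p.g x (z i) ≤ 0}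

theorem feas_comp (e : κ ↪ ι) (z : ι → Z) (I : Finset κ) :
    p.feas (fun k => z (e k)) I = p.feas z (I.map e) := by
  ext x
  simp [feas]

theorem feas_anti (z : ι → Z) {I J : Finset ι} (h : J ⊆ I) : p.feas z I ⊆ p.feas z J :=
  fun _ hx => ⟨hx.1, fun i hi => hx.2 i (h hi)⟩

theorem convex_feas (z : ι → Z) (I : Finset ι) : Convex ℝ (p.feas z I) := by
  have : p.feas z I = p.K ∩ ⋂ i ∈ I, {x ∈ p.K | p.g x (z i) ≤ 0} := by
    ext x
    simp only [feas, Set.mem_ofPred_eq, Set.mem_inter_iff, Set.mem_iInter]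
    exact ⟨fun h => ⟨h.1, fun i hi => ⟨h.1, h.2 i hi⟩⟩, fun h => ⟨h.1, fun i hi => (h.2 i hi).2⟩⟩
  rw [this]
  exact p.strictConvexOn_φ.1.inter
    (convex_iInter₂ fun i _ => (p.convexOn_g (z i)).convex_le 0)

theorem isCompact_feas (z : ι → Z) (I : Finset ι) : IsCompact (p.feas z I) := by
  have : p.feas z I = p.K ∩ ⋂ i ∈ I, p.K ∩ (fun x => p.g x (z i)) ⁻¹' Set.Iic 0 := by
    ext x
    simp only [feas, Set.mem_ofPred_eq, Set.mem_inter_iff, Set.mem_iInter, Set.mem_preimage,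
      Set.mem_Iic]
    exact ⟨fun h => ⟨h.1, fun i hi => ⟨h.1, h.2 i hi⟩⟩, fun h => ⟨h.1, fun i hi => (h.2 i hi).2⟩⟩
  rw [this]
  exact p.isCompact.inter_right (isClosed_biInter fun i _ =>
    (p.continuousOn_g (z i)).preimage_isClosed_of_isClosed p.isCompact.isClosed isClosed_Iic)

theorem exists_forall_mem_feas : ∃ x, ∀ (z : ι → Z) (I : Finset ι), x ∈ p.feas z I := by
  obtain ⟨x, hx, h⟩ := p.exists_feasible
  exact ⟨x, fun z I => ⟨hx, fun i _ => h _⟩⟩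

theorem exists_minimizer (z : ι → Z) (I : Finset ι) :
    ∃ x ∈ p.feas z I, ∀ y ∈ p.feas z I, p.φ x ≤ p.φ y := by
  obtain ⟨x, hx⟩ := p.exists_forall_mem_feas (ι := ι)
  obtain ⟨y, hy, hmin⟩ := (p.isCompact_feas z I).exists_isMinOn ⟨x, hx z I⟩
    (p.continuousOn_φ.mono fun _ h => h.1)
  exact ⟨y, hy, hmin⟩

/-- The minimizer of the program with the constraints in `I`. -/
noncomputable def sol (z : ι → Z) (I : Finset ι) : E := (p.exists_minimizer z I).choose

theorem sol_mem (z : ι → Z) (I : Finset ι) : p.sol z I ∈ p.feas z I :=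
  (p.exists_minimizer z I).choose_spec.1

theorem φ_sol_le {z : ι → Z} {I : Finset ι} {y : E} (hy : y ∈ p.feas z I) :
    p.φ (p.sol z I) ≤ p.φ y :=
  (p.exists_minimizer z I).choose_spec.2 y hy

theorem eq_of_minimizers {S : Set E} (hS : Convex ℝ S) (hSK : S ⊆ p.K) {x y : E} (hx : x ∈ S)
    (hy : y ∈ S) (hx' : ∀ u ∈ S, p.φ x ≤ p.φ u) (hy' : ∀ u ∈ S, p.φ y ≤ p.φ u) : x = y :=
  (p.strictConvexOn_φ.subset hSK hS).eq_of_isMinOn hx' hy' hx hy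

theorem eq_sol {z : ι → Z} {I : Finset ι} {y : E} (hy : y ∈ p.feas z I)
    (h : p.φ y ≤ p.φ (p.sol z I)) : p.sol z I = y :=
  p.eq_of_minimizers (p.convex_feas z I) (fun _ h => h.1) (p.sol_mem z I) hy
    (fun _ hu => p.φ_sol_le hu) (fun _ hu => h.trans (p.φ_sol_le hu))

theorem sol_congr {z : ι → Z} {w : κ → Z} {I : Finset ι} {J : Finset κ}
    (h : p.feas z I = p.feas w J) : p.sol z I = p.sol w J :=
  p.eq_sol (h ▸ p.sol_mem w J) (p.φ_sol_le (h ▸ p.sol_mem z I))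

theorem sol_comp (e : κ ↪ ι) (z : ι → Z) (I : Finset κ) :
    p.sol (fun k => z (e k)) I = p.sol z (I.map e) :=
  p.sol_congr (p.feas_comp e z I)

theorem sol_eq_of_subset {z : ι → Z} {I J : Finset ι} (h : J ⊆ I) (hm : p.sol z J ∈ p.feas z I) :
    p.sol z I = p.sol z J :=
  p.eq_sol hm (p.φ_sol_le (p.feas_anti z h (p.sol_mem z I)))

/-- The minimizer is determined by at most as many constraints as there are dimensions. -/
theorem exists_subset_sol_eq [FiniteDimensional ℝ E] (z : ι → Z) (I : Finset ι) :
    ∃ B ⊆ I, B.card ≤ Module.finrank ℝ E ∧ p.sol z B = p.sol z I := by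
  classical
  by_contra! hne
  have hlt : ∀ B ⊆ I, B.card ≤ Module.finrank ℝ E → p.φ (p.sol z B) < p.φ (p.sol z I) := by
    intro B hB hc
    by_contra! hle
    exact hne B hB hc (p.eq_sol (p.feas_anti z hB (p.sol_mem z I)) hle)
  -- Helly's theorem for the constraint sets together with the set of strictly better points,
  -- indexed by `none`. Subfamilies containing `none` meet at the minimizer for their few
  -- constraints, the others at the minimizer for `I`; a common point of all would beat the optimum.
  let F : Option ι → Set E := fun o => o.elim {x ∈ p.K | p.φ x < p.φ (p.sol z I)}
    (fun i => {x ∈ p.K | p.g x (z i) ≤ 0})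
  obtain ⟨x, hx⟩ : (⋂ o ∈ Finset.insertNone I, F o).Nonempty := by
    refine Convex.helly_theorem' (𝕜 := ℝ) (fun o _ => ?_) (fun J hJ hc => ?_)
    · rcases o with _ | i
      · exact p.strictConvexOn_φ.convexOn.convex_lt _
      · exact (p.convexOn_g (z i)).convex_le 0
    · by_cases hn : none ∈ J
      · have hB : Finset.eraseNone J ⊆ I := fun i hi => by
          have := hJ (Finset.mem_eraseNone.1 hi)
          simpa using this
        have hBc : (Finset.eraseNone J).card ≤ Module.finrank ℝ E := by
          have h1 : (Finset.eraseNone J).card + 1 = J.card := by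
            rw [← Finset.card_insertNone, Finset.insertNone_eraseNone, Finset.insert_eq_of_mem hn]
          omega
        have hs := p.sol_mem z (Finset.eraseNone J)
        refine ⟨p.sol z (Finset.eraseNone J), Set.mem_iInter₂.2 fun o ho => ?_⟩
        rcases o with _ | i
        · exact ⟨hs.1, hlt _ hB hBc⟩
        · exact ⟨hs.1, hs.2 i (Finset.mem_eraseNone.2 ho)⟩
      · have hs := p.sol_mem z I
        refine ⟨p.sol z I, Set.mem_iInter₂.2 fun o ho => ?_⟩
        rcases o with _ | i
        · exact absurd ho hn
        · exact ⟨hs.1, hs.2 i (by simpa using hJ ho)⟩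
  have hx' : ∀ o ∈ Finset.insertNone I, x ∈ F o := Set.mem_iInter₂.1 hx
  have h0 : x ∈ p.K ∧ p.φ x < p.φ (p.sol z I) := hx' none (by simp)
  have : x ∈ p.feas z I := ⟨h0.1, fun i hi => (hx' (some i) (by simpa using hi)).2⟩
  exact absurd h0.2 (p.φ_sol_le this).not_gt

/-- All constraints in `I` matter: leaving out any of them changes the minimizer. -/
def Essential [DecidableEq ι] (z : ι → Z) (I : Finset ι) : Prop :=
  ∀ i ∈ I, p.sol z (I.erase i) ≠ p.sol z I

theorem exists_combo_nonpos {a : ℝ} (ha : a < 0) (b : ℝ) :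
    ∃ s : ℝ, 0 < s ∧ s ≤ 1 ∧ (1 - s) * a + s * b ≤ 0 := by
  have hpos : 0 < |b| - a := by linarith [abs_nonneg b]
  -- With `|b|` in place of `b` the denominator is positive and the ratio at most `1`, whatever the
  -- sign of `b`.
  refine ⟨-a / (|b| - a), div_pos (by linarith) hpos, ?_, ?_⟩
  · rw [div_le_one hpos]
    linarith [abs_nonneg b]
  · have : (1 - -a / (|b| - a)) * a + -a / (|b| - a) * b = a * (|b| - b) / (|b| - a) := by
      field_simp
      ring
    rw [this]
    exact div_nonpos_of_nonpos_of_nonneg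
      (mul_nonpos_of_nonpos_of_nonneg ha.le (by linarith [le_abs_self b])) hpos.le

/-- An inactive constraint does not matter. -/
theorem sol_erase_eq [DecidableEq ι] {z : ι → Z} {I : Finset ι} {j : ι}
    (hneg : p.g (p.sol z I) (z j) < 0) : p.sol z (I.erase j) = p.sol z I := by
  set x := p.sol z I with hxdef
  set y := p.sol z (I.erase j) with hydef
  have hxI : x ∈ p.feas z I := p.sol_mem z I
  have hx : x ∈ p.feas z (I.erase j) := p.feas_anti z (Finset.erase_subset _ _) hxI
  have hy : y ∈ p.feas z (I.erase j) := p.sol_mem z _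
  by_contra hne
  have hlt : p.φ y < p.φ x := by
    by_contra! hle
    exact hne (p.eq_sol hx hle)
  -- A step from `x` towards the better point `y`, short enough to keep constraint `j`, would be
  -- feasible for `I` and lower `φ`.
  obtain ⟨s, hs0, hs1, hs⟩ := exists_combo_nonpos hneg (p.g y (z j))
  have hmem : (1 - s) • x + s • y ∈ p.feas z (I.erase j) :=
    p.convex_feas z _ hx hy (by linarith) hs0.le (by ring)
  have hg := (p.convexOn_g (z j)).2 hx.1 hy.1 (by linarith : 0 ≤ 1 - s) hs0.le (by ring)
  have hφ := p.strictConvexOn_φ.convexOn.2 hx.1 hy.1 (by linarith : 0 ≤ 1 - s) hs0.le (by ring)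
  simp only [smul_eq_mul] at hg hφ
  have hmem' : (1 - s) • x + s • y ∈ p.feas z I := by
    refine ⟨hmem.1, fun i hi => ?_⟩
    by_cases hij : i = j
    · subst hij
      exact hg.trans hs
    · exact hmem.2 i (Finset.mem_erase.2 ⟨hij, hi⟩)
  have := p.φ_sol_le hmem'
  nlinarith

theorem exists_essential [DecidableEq ι] [FiniteDimensional ℝ E] (z : ι → Z) (I : Finset ι) :
    ∃ B ⊆ I, B.card ≤ Module.finrank ℝ E ∧ p.Essential z B ∧ p.sol z B = p.sol z I := by
  classical
  obtain ⟨B, hB, hmin⟩ := (I.powerset.filter fun B => p.sol z B = p.sol z I).exists_min_image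
    Finset.card ⟨I, by simp⟩
  simp only [Finset.mem_filter, Finset.mem_powerset] at hB hmin
  refine ⟨B, hB.1, ?_, fun i hi h => ?_, hB.2⟩
  · obtain ⟨B', hB', hc, hs⟩ := p.exists_subset_sol_eq z B
    exact (hmin B' ⟨hB'.trans hB.1, hs.trans hB.2⟩).trans hc
  · have := hmin (B.erase i) ⟨(Finset.erase_subset _ _).trans hB.1, h.trans hB.2⟩
    exact absurd this (Finset.card_erase_lt_of_mem hi).not_ge

/-- A member of `C` outside `B` would be inactive at the common minimizer, so removing it could not
change that minimizer. Applied in both directions, this gives uniqueness of the basis. -/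
theorem essential_subset [DecidableEq ι] {z : ι → Z} {B C : Finset ι}
    (hC : p.Essential z C) (h : p.sol z B = p.sol z C)
    (hBs : ∀ j ∉ B, p.g (p.sol z B) (z j) < 0) : C ⊆ B := by
  intro j hj
  by_contra hjB
  exact hC j hj (p.sol_erase_eq (h ▸ hBs j hjB))

/-- In a nondegenerate program there is exactly one essential set of constraints that determines
the minimizer. -/
theorem existsUnique_basis [Fintype ι] [DecidableEq ι] [FiniteDimensional ℝ E] {z : ι → Z}
    (hz : ∀ I : Finset ι, ∀ j ∉ I, p.g (p.sol z I) (z j) ≠ 0) :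
    ∃! B : Finset ι, B.card ≤ Module.finrank ℝ E ∧ p.Essential z B ∧
      ∀ j ∉ B, p.g (p.sol z B) (z j) ≤ 0 := by
  have hsol : ∀ B : Finset ι, (∀ j ∉ B, p.g (p.sol z B) (z j) ≤ 0) →
      p.sol z Finset.univ = p.sol z B := fun B hB =>
    p.sol_eq_of_subset (Finset.subset_univ B) ⟨(p.sol_mem z B).1, fun i _ => by
      by_cases hi : i ∈ B
      · exact (p.sol_mem z B).2 i hi
      · exact hB i hi⟩
  obtain ⟨B, -, hc, hess, hs⟩ := p.exists_essential z Finset.univ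
  have hBs : ∀ j ∉ B, p.g (p.sol z B) (z j) ≤ 0 := fun j _ => by
    rw [hs]
    exact (p.sol_mem z Finset.univ).2 j (Finset.mem_univ j)
  refine ⟨B, ⟨hc, hess, hBs⟩, fun C hC => ?_⟩
  have hBC : p.sol z B = p.sol z C := hs.trans (hsol C hC.2.2)
  exact Finset.Subset.antisymm
    (p.essential_subset hC.2.1 hBC fun j hj => lt_of_le_of_ne (hBs j hj) (hz B j hj))
    (p.essential_subset hess hBC.symm fun j hj => lt_of_le_of_ne (hC.2.2 j hj) (hz C j hj))

theorem essential_comp [DecidableEq ι] [DecidableEq κ] (e : κ ↪ ι) (z : ι → Z) (J : Finset κ) :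
    p.Essential (fun k => z (e k)) J ↔ p.Essential z (J.map e) := by
  simp only [Essential, Finset.mem_map, forall_exists_index, and_imp,
    forall_apply_eq_imp_iff₂, sol_comp, Finset.map_erase]

theorem sol_subtype (z : ι → Z) (I : Finset ι) :
    p.sol (fun i : I => z i) Finset.univ = p.sol z I :=
  (p.sol_comp (Function.Embedding.subtype (· ∈ I)) z Finset.univ).trans
    (congrArg (p.sol z) Finset.attach_map_val)

theorem essential_subtype [DecidableEq ι] (z : ι → Z) (I : Finset ι) :
    p.Essential (fun i : I => z i) Finset.univ ↔ p.Essential z I :=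
  (p.essential_comp (Function.Embedding.subtype (· ∈ I)) z Finset.univ).trans
    (iff_of_eq (congrArg (p.Essential z) Finset.attach_map_val))

theorem sol_equiv [Fintype ι] [Fintype κ] (e : κ ≃ ι) (z : ι → Z) :
    p.sol (fun k => z (e k)) Finset.univ = p.sol z Finset.univ :=
  (p.sol_comp e.toEmbedding z Finset.univ).trans (by simp)

theorem essential_equiv [Fintype ι] [Fintype κ] [DecidableEq ι] [DecidableEq κ] (e : κ ≃ ι)
    (z : ι → Z) :
    p.Essential (fun k => z (e k)) Finset.univ ↔ p.Essential z Finset.univ :=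
  (p.essential_comp e.toEmbedding z Finset.univ).trans (by simp)

end ConvexFamily

/-! ### Measurability of minimizers -/

/-- Solvability over a compact set of a constraint continuous in the point and measurable in the
parameter is a measurable event. -/
theorem measurableSet_exists_le_zero {E W : Type*} [PseudoMetricSpace E] [MeasurableSpace W]
    {C : Set E} (hC : IsCompact C) {H : E → W → ℝ} (hcont : ∀ w, ContinuousOn (fun x => H x w) C)
    (hmeas : ∀ x ∈ C, Measurable (H x)) : MeasurableSet {w | ∃ x ∈ C, H x w ≤ 0} := by
  obtain ⟨S, hSC, hS, hCS⟩ := hC.isSeparable.exists_countable_dense_subset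
  -- The minimum over `C` is attained by compactness, and by continuity it is the infimum over the
  -- countable dense set `S`.
  have : {w | ∃ x ∈ C, H x w ≤ 0} = ⋂ k : ℕ, ⋃ s ∈ S, {w | H s w < 1 / ((k : ℝ) + 1)} := by
    ext w
    simp only [Set.mem_ofPred_eq, Set.mem_iInter, Set.mem_iUnion, exists_prop]
    constructor
    · rintro ⟨x, hx, hxw⟩ k
      have hk : H x w < 1 / ((k : ℝ) + 1) := hxw.trans_lt (by positivity)
      have hne : (nhdsWithin x S).NeBot := mem_closure_iff_nhdsWithin_neBot.1 (hCS hx)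
      have hev := (((hcont w) x hx).mono hSC).eventually_lt_const hk
      obtain ⟨s, hs, hsS⟩ := (hev.and self_mem_nhdsWithin).exists
      exact ⟨s, hsS, hs⟩
    · intro h
      obtain ⟨s, hs, -⟩ := h 0
      obtain ⟨x, hx, hmin⟩ := hC.exists_isMinOn ⟨s, hSC hs⟩ (hcont w)
      refine ⟨x, hx, le_of_forall_pos_lt_add fun δ hδ => ?_⟩
      obtain ⟨k, hk⟩ := exists_nat_one_div_lt hδ
      obtain ⟨s, hs, hsk⟩ := h k
      rw [zero_add]
      exact ((hmin (hSC hs)).trans_lt hsk).trans hk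
  rw [this]
  exact MeasurableSet.iInter fun k => MeasurableSet.biUnion hS fun s hs =>
    measurableSet_lt (hmeas s (hSC hs)) measurable_const

namespace ConvexFamily

variable {E Z ι κ : Type*} [NormedAddCommGroup E] [NormedSpace ℝ E]
  [MeasurableSpace E] [MeasurableSpace Z] {p : ConvexFamily E Z}

theorem measurable_g_const (hg : Measurable fun q : E × Z => p.g q.1 q.2) (x : E) :
    Measurable (p.g x) := hg.comp measurable_prodMk_left

theorem measurableSet_exists_feas (hg : Measurable fun q : E × Z => p.g q.1 q.2)
    {C : Set E} (hC : IsCompact C) (hCK : C ⊆ p.K) (I : Finset ι) (a : ℝ) :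
    MeasurableSet {z : ι → Z | ∃ x ∈ C, x ∈ p.feas z I ∧ p.φ x ≤ a} := by
  -- All constraints and the bound on `φ` are merged into one sum of positive parts, which is
  -- nonpositive exactly when each part vanishes.
  have hH := measurableSet_exists_le_zero (W := ι → Z) hC
    (H := fun x z => max (p.φ x - a) 0 + ∑ i ∈ I, max (p.g x (z i)) 0) (fun z => ?_) (fun x _ => ?_)
  · convert hH using 1
    ext z
    simp only [Set.mem_ofPred_eq]
    refine exists_congr fun x => and_congr_right fun hx => ?_
    have h0 : 0 ≤ ∑ i ∈ I, max (p.g x (z i)) 0 := Finset.sum_nonneg fun i _ => le_max_right _ _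
    have h1 : 0 ≤ max (p.φ x - a) 0 := le_max_right _ _
    constructor
    · rintro ⟨hf, ha⟩
      rw [max_eq_right (by linarith), zero_add]
      exact (Finset.sum_eq_zero fun i hi => max_eq_right (hf.2 i hi)).le
    · intro hle
      have hs : ∑ i ∈ I, max (p.g x (z i)) 0 = 0 := by linarith
      rw [Finset.sum_eq_zero_iff_of_nonneg fun i _ => le_max_right _ _] at hs
      refine ⟨⟨hCK hx, fun i hi => max_eq_right_iff.1 (hs i hi)⟩, ?_⟩
      linarith [le_max_left (p.φ x - a) 0]
  · refine ContinuousOn.add ?_ (continuousOn_finsetSum _ fun i _ => ?_)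
    · exact ((p.continuousOn_φ.mono hCK).sub continuousOn_const).sup continuousOn_const
    · exact ((p.continuousOn_g (z i)).mono hCK).sup continuousOn_const
  · refine measurable_const.add (Finset.measurable_sum _ fun i _ => ?_)
    exact ((measurable_g_const hg x).comp (measurable_pi_apply i)).max measurable_const

variable [BorelSpace E]

theorem measurable_sol (hg : Measurable fun q : E × Z => p.g q.1 q.2) (I : Finset ι) :
    Measurable fun z : ι → Z => p.sol z I := by
  refine measurable_of_isClosed fun F hF => ?_
  -- By uniqueness, the minimizer lies in `F` exactly when every rational level reached by a
  -- feasible point is also reached by one in `F`.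
  have : (fun z : ι → Z => p.sol z I) ⁻¹' F = ⋂ a : ℚ,
      {z | ∃ x ∈ p.K, x ∈ p.feas z I ∧ p.φ x ≤ a}ᶜ ∪
        {z | ∃ x ∈ p.K ∩ F, x ∈ p.feas z I ∧ p.φ x ≤ a} := by
    ext z
    simp only [Set.mem_preimage, Set.mem_iInter, Set.mem_union, Set.mem_compl_iff,
      Set.mem_ofPred_eq, ← imp_iff_not_or]
    have hs := p.sol_mem z I
    constructor
    · rintro hF a ⟨x, -, hx, hxa⟩
      exact ⟨p.sol z I, ⟨hs.1, hF⟩, hs, (p.φ_sol_le hx).trans hxa⟩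
    · intro h
      by_contra hnF
      obtain ⟨a₀, ha₀⟩ := exists_rat_gt (p.φ (p.sol z I))
      obtain ⟨x, hxF, hx, -⟩ := h a₀ ⟨_, hs.1, hs, ha₀.le⟩
      obtain ⟨y, hy, hmin⟩ := ((p.isCompact_feas z I).inter_right hF).exists_isMinOn
        ⟨x, hx, hxF.2⟩ (p.continuousOn_φ.mono fun _ h => h.1.1)
      have hlt : p.φ (p.sol z I) < p.φ y := by
        by_contra! hle
        exact hnF (p.eq_sol hy.1 hle ▸ hy.2)
      obtain ⟨a, ha1, ha2⟩ := exists_rat_btwn hlt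
      obtain ⟨u, huF, hu, hua⟩ := h a ⟨_, hs.1, hs, ha1.le⟩
      have := hmin ⟨hu, huF.2⟩
      simp only [Set.mem_ofPred_eq] at this
      linarith
  rw [this]
  exact MeasurableSet.iInter fun a =>
    (measurableSet_exists_feas hg p.isCompact subset_rfl I a).compl.union
      (measurableSet_exists_feas hg (p.isCompact.inter_right hF) Set.inter_subset_left I a)

theorem measurableSet_essential [DecidableEq ι] (hg : Measurable fun q : E × Z => p.g q.1 q.2)
    [SecondCountableTopology E] (I : Finset ι) : MeasurableSet {z : ι → Z | p.Essential z I} := by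
  have : {z : ι → Z | p.Essential z I} =
      ⋂ i ∈ I, {z | p.sol z (I.erase i) = p.sol z I}ᶜ := by
    ext z
    simp [Essential]
  rw [this]
  exact MeasurableSet.biInter I.countable_toSet fun i _ =>
    (measurableSet_eq_fun (measurable_sol hg _) (measurable_sol hg _)).compl

end ConvexFamily

/-! ### The law of the basis and the binomial bound -/

/-- Splitting off the coordinates in `I` of a product measure. -/
theorem pi_apply_eq_lintegral {Z ι : Type*} [Fintype ι] [DecidableEq ι] [MeasurableSpace Z]
    (μ : Measure Z) [IsProbabilityMeasure μ] (I : Finset ι)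
    {S : Set ((I → Z) × ({i // i ∉ I} → Z))} (hS : MeasurableSet S) :
    Measure.pi (fun _ : ι => μ) {z | ((fun i : I => z i), fun i : {i // i ∉ I} => z i) ∈ S} =
      ∫⁻ w, Measure.pi (fun _ : {i // i ∉ I} => μ) {v | (w, v) ∈ S}
        ∂Measure.pi (fun _ : I => μ) := by
  have h := measurePreserving_piEquivPiSubtypeProd (fun _ : ι => μ) (fun i => i ∈ I)
  have h2 := h.measure_preimage hS.nullMeasurableSet
  rw [Measure.prod_apply hS] at h2
  convert! h2 using 2
  congr!

namespace ConvexFamily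

variable {E Z ι : Type*} [NormedAddCommGroup E] [NormedSpace ℝ E]
  [MeasurableSpace E] [MeasurableSpace Z] (p : ConvexFamily E Z)
  (μ : Measure Z) [IsProbabilityMeasure μ]

/-- The probability that `x` satisfies the constraint of a random scenario. -/
noncomputable def satProb (x : E) : ℝ := μ.real {v | p.g x v ≤ 0}

variable {p} in
theorem measurable_satProb (hg : Measurable fun q : E × Z => p.g q.1 q.2) :
    Measurable (p.satProb μ) :=
  (measurable_measure_prodMk_left (measurableSet_le hg measurable_const)).ennreal_toReal

/-- The distribution of the satisfaction probability of the minimizer for `k` random scenarios, on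
the event that these are all essential. -/
noncomputable def basisLaw (k : ℕ) : Measure ℝ :=
  ((Measure.pi fun _ : Fin k => μ).restrict {w | p.Essential w Finset.univ}).map
    fun w => p.satProb μ (p.sol w Finset.univ)

/-- The event that `I` is a basis, and that the satisfaction probability of its minimizer belongs
to `A`. -/
def basisEvent [DecidableEq ι] (I : Finset ι) (A : Set ℝ) : Set (ι → Z) :=
  {z | (p.Essential z I ∧ p.satProb μ (p.sol z I) ∈ A) ∧ ∀ j ∉ I, p.g (p.sol z I) (z j) ≤ 0}

variable {p} [BorelSpace E]

theorem measurableSet_basisEvent [Fintype ι] [DecidableEq ι] [SecondCountableTopology E]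
    (hg : Measurable fun q : E × Z => p.g q.1 q.2)
    (I : Finset ι) {A : Set ℝ} (hA : MeasurableSet A) : MeasurableSet (p.basisEvent μ I A) := by
  refine ((measurableSet_essential hg I).inter
    ((measurable_satProb μ hg).comp (measurable_sol hg I) hA)).inter ?_
  have : {z : ι → Z | ∀ j ∉ I, p.g (p.sol z I) (z j) ≤ 0} =
      ⋂ j, ⋂ (_ : j ∉ I), {z | p.g (p.sol z I) (z j) ≤ 0} := by
    ext z
    simp
  change MeasurableSet {z : ι → Z | ∀ j ∉ I, p.g (p.sol z I) (z j) ≤ 0}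
  rw [this]
  exact MeasurableSet.iInter fun j => MeasurableSet.iInter fun _ =>
    measurableSet_le (hg.comp ((measurable_sol hg I).prodMk (measurable_pi_apply j)))
      measurable_const

/-- Minimizer and essentiality depend only on the scenarios in `I`. Given these, the remaining
scenarios are independent, and each is satisfied with probability `t`, the satisfaction probability
of the minimizer. -/
theorem pi_basisEvent [Fintype ι] [DecidableEq ι] [SecondCountableTopology E]
    (hg : Measurable fun q : E × Z => p.g q.1 q.2)
    (I : Finset ι) {A : Set ℝ} (hA : MeasurableSet A) :
    Measure.pi (fun _ : ι => μ) (p.basisEvent μ I A) =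
      ∫⁻ t in A, ENNReal.ofReal t ^ (Fintype.card ι - I.card) ∂p.basisLaw μ I.card := by
  let S : Set ((I → Z) × ({i // i ∉ I} → Z)) :=
    {q | (p.Essential q.1 Finset.univ ∧ p.satProb μ (p.sol q.1 Finset.univ) ∈ A) ∧
      ∀ j, p.g (p.sol q.1 Finset.univ) (q.2 j) ≤ 0}
  have hS : MeasurableSet S := by
    refine MeasurableSet.inter (measurable_fst ((measurableSet_essential hg _).inter
      ((measurable_satProb μ hg).comp (measurable_sol hg _) hA))) ?_
    change MeasurableSet {q : (I → Z) × ({i // i ∉ I} → Z) |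
      ∀ j, p.g (p.sol q.1 Finset.univ) (q.2 j) ≤ 0}
    rw [Set.ofPred_forall]
    exact MeasurableSet.iInter fun j => measurableSet_le
      (hg.comp (((measurable_sol hg _).comp measurable_fst).prodMk
        ((measurable_pi_apply j).comp measurable_snd))) measurable_const
  have hev : p.basisEvent μ I A =
      {z | ((fun i : I => z i), fun i : {i // i ∉ I} => z i) ∈ S} := by
    ext z
    simp only [basisEvent, S, Set.mem_ofPred_eq, sol_subtype, essential_subtype, Subtype.forall]
  have hsec : ∀ w : I → Z, Measure.pi (fun _ : {i // i ∉ I} => μ) {v | (w, v) ∈ S} =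
      {w : I → Z | p.Essential w Finset.univ ∧
        p.satProb μ (p.sol w Finset.univ) ∈ A}.indicator
        (fun w => ENNReal.ofReal (p.satProb μ (p.sol w Finset.univ)) ^
          (Fintype.card ι - I.card)) w := fun w => by
    by_cases hw : w ∈ {w : I → Z | p.Essential w Finset.univ ∧
        p.satProb μ (p.sol w Finset.univ) ∈ A}
    · rw [Set.indicator_of_mem hw]
      have : {v : {i // i ∉ I} → Z | (w, v) ∈ S} =
          Set.pi Set.univ fun _ => {v | p.g (p.sol w Finset.univ) v ≤ 0} := by
        ext v
        simp only [S, Set.mem_ofPred_eq, Set.mem_pi, Set.mem_univ, true_imp_iff]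
        exact ⟨fun h => h.2, fun h => ⟨hw, h⟩⟩
      rw [this, Measure.pi_pi, Finset.prod_const, satProb, ofReal_measureReal]
      congr 1
      rw [Finset.card_univ, Fintype.card_subtype_compl, Fintype.card_coe]
    · rw [Set.indicator_of_notMem hw]
      have : {v : {i // i ∉ I} → Z | (w, v) ∈ S} = ∅ := by
        ext v
        simp only [Set.mem_ofPred_eq, Set.mem_empty_iff_false, iff_false]
        exact fun h => hw h.1
      rw [this, measure_empty]
  -- Reindexing `I` by `Fin I.card` shows that only the cardinality of `I` matters.
  have hmp := measurePreserving_arrowCongr' (fun _ : Fin I.card => μ) (fun _ : I => μ)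
    I.equivFin.symm (MeasurableEquiv.refl Z) (fun _ => MeasurePreserving.id μ)
  have hsat : Measurable fun w : Fin I.card → Z => p.satProb μ (p.sol w Finset.univ) :=
    (measurable_satProb μ hg).comp (measurable_sol hg _)
  rw [hev, pi_apply_eq_lintegral μ I hS, lintegral_congr hsec,
    ← hmp.lintegral_comp_emb (MeasurableEquiv.measurableEmbedding _), basisLaw,
    setLIntegral_map hA (by fun_prop) hsat, Measure.restrict_restrict (hsat hA),
    ← lintegral_indicator ((hsat hA).inter (measurableSet_essential hg _))]
  refine lintegral_congr fun w => ?_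
  have hw : (MeasurableEquiv.arrowCongr' I.equivFin.symm (MeasurableEquiv.refl Z)) w =
      fun i : I => w (I.equivFin i) := rfl
  have hsol := sol_equiv (p := p) I.equivFin w
  have hess := essential_equiv (p := p) I.equivFin w
  rw [hw]
  have hiff : (fun i : I => w (I.equivFin i)) ∈ {w : I → Z | p.Essential w Finset.univ ∧
      p.satProb μ (p.sol w Finset.univ) ∈ A} ↔
      w ∈ (fun w => p.satProb μ (p.sol w Finset.univ)) ⁻¹' A ∩
        {w | p.Essential w Finset.univ} := by
    rw [Set.mem_ofPred_eq, hess, hsol, and_comm]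
    rfl
  by_cases h : w ∈ (fun w => p.satProb μ (p.sol w Finset.univ)) ⁻¹' A ∩
      {w | p.Essential w Finset.univ}
  · rw [Set.indicator_of_mem (hiff.2 h), Set.indicator_of_mem h, hsol]
  · rw [Set.indicator_of_notMem fun h' => h (hiff.1 h'), Set.indicator_of_notMem h]

/-- If every point satisfies almost no constraint with equality, then random programs are
nondegenerate. -/
theorem ae_nondegenerate [Fintype ι] [SecondCountableTopology E]
    (hg : Measurable fun q : E × Z => p.g q.1 q.2) (hnd : ∀ x ∈ p.K, μ {v | p.g x v = 0} = 0) :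
    ∀ᵐ z ∂Measure.pi (fun _ : ι => μ), ∀ I : Finset ι, ∀ j ∉ I, p.g (p.sol z I) (z j) ≠ 0 := by
  classical
  rw [ae_all_iff]
  intro I
  let S : Set ((I → Z) × ({i // i ∉ I} → Z)) :=
    {q | ∃ j, p.g (p.sol q.1 Finset.univ) (q.2 j) = 0}
  have hS : MeasurableSet S := by
    change MeasurableSet {q : (I → Z) × ({i // i ∉ I} → Z) |
      ∃ j, p.g (p.sol q.1 Finset.univ) (q.2 j) = 0}
    rw [Set.ofPred_exists]
    exact MeasurableSet.iUnion fun j => measurableSet_eq_fun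
      (hg.comp (((measurable_sol hg _).comp measurable_fst).prodMk
        ((measurable_pi_apply j).comp measurable_snd))) measurable_const
  have hev : {z : ι → Z | ¬ ∀ j ∉ I, p.g (p.sol z I) (z j) ≠ 0} =
      {z | ((fun i : I => z i), fun i : {i // i ∉ I} => z i) ∈ S} := by
    ext z
    simp only [S, Set.mem_ofPred_eq, sol_subtype, Subtype.exists]
    push Not
    simp only [exists_prop]
  rw [ae_iff, hev, pi_apply_eq_lintegral μ I hS]
  -- With the scenarios in `I` fixed, the minimizer is a fixed point of `K`, and each further
  -- scenario is active there with probability zero.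
  refine (lintegral_congr fun w => ?_).trans lintegral_zero
  have : {v : {i // i ∉ I} → Z | (w, v) ∈ S} =
      ⋃ j, (Function.eval j) ⁻¹' {v | p.g (p.sol w Finset.univ) v = 0} := by
    ext v
    simp [S]
  rw [this, measure_iUnion_null_iff]
  intro j
  rw [(measurePreserving_eval (fun _ : {i // i ∉ I} => μ) j).measure_preimage
    (measurableSet_eq_fun (measurable_g_const hg _) measurable_const).nullMeasurableSet]
  exact hnd _ (p.sol_mem w _).1

instance (k : ℕ) : IsFiniteMeasure (p.basisLaw μ k) := by
  unfold basisLaw; infer_instance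

theorem ae_basisLaw_mem_Icc (hg : Measurable fun q : E × Z => p.g q.1 q.2) (k : ℕ) :
    ∀ᵐ t ∂p.basisLaw μ k, t ∈ Set.Icc (0 : ℝ) 1 := by
  have hsat : Measurable fun w : Fin k → Z => p.satProb μ (p.sol w Finset.univ) :=
    (measurable_satProb μ hg).comp (measurable_sol hg _)
  refine (ae_map_iff (p := fun t => t ∈ Set.Icc (0 : ℝ) 1) hsat.aemeasurable measurableSet_Icc).2 ?_
  exact Filter.Eventually.of_forall fun w => ⟨measureReal_nonneg, measureReal_le_one⟩

theorem real_pi_basisEvent [Fintype ι] [DecidableEq ι] [SecondCountableTopology E]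
    (hg : Measurable fun q : E × Z => p.g q.1 q.2)
    (I : Finset ι) {A : Set ℝ} (hA : MeasurableSet A) :
    (Measure.pi (fun _ : ι => μ)).real (p.basisEvent μ I A) =
      ∫ t in A, t ^ (Fintype.card ι - I.card) ∂p.basisLaw μ I.card := by
  rw [integral_eq_lintegral_of_nonneg_ae, Measure.real, pi_basisEvent μ hg I hA]
  · congr 1
    refine lintegral_congr_ae (ae_restrict_of_ae ?_)
    filter_upwards [ae_basisLaw_mem_Icc μ hg I.card] with t ht
    rw [ENNReal.ofReal_pow ht.1]
  · refine ae_restrict_of_ae ?_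
    filter_upwards [ae_basisLaw_mem_Icc μ hg I.card] with t ht
    exact pow_nonneg ht.1 _
  · exact (continuous_pow _).aestronglyMeasurable

theorem sum_real_basisEvent [Fintype ι] [DecidableEq ι] [SecondCountableTopology E]
    (hg : Measurable fun q : E × Z => p.g q.1 q.2) (n : ℕ) {A : Set ℝ} (hA : MeasurableSet A) :
    ∑ I : Finset ι with I.card ≤ n, (Measure.pi (fun _ : ι => μ)).real (p.basisEvent μ I A) =
      ∑ k ∈ Finset.range (n + 1), ((Fintype.card ι).choose k : ℝ) *
        ∫ t in A, t ^ (Fintype.card ι - k) ∂p.basisLaw μ k := by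
  rw [← Finset.sum_fiberwise_of_maps_to (s := Finset.univ.filter fun I : Finset ι => I.card ≤ n)
    (t := Finset.range (n + 1)) (g := Finset.card) (fun I hI => by
      have := (Finset.mem_filter.1 hI).2
      exact Finset.mem_range.2 (by omega))]
  refine Finset.sum_congr rfl fun k hk => ?_
  have hk' : k ≤ n := by have := Finset.mem_range.1 hk; omega
  have : (Finset.univ.filter fun I : Finset ι => I.card ≤ n).filter (fun I => I.card = k) =
      Finset.powersetCard k Finset.univ := by
    ext I
    simp only [Finset.mem_filter, Finset.mem_univ, true_and, Finset.mem_powersetCard,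
      Finset.subset_univ]
    omega
  rw [this, ← Finset.card_univ, ← Finset.card_powersetCard, ← nsmul_eq_mul]
  refine Finset.sum_eq_card_nsmul fun I hI => ?_
  rw [real_pi_basisEvent μ hg I hA, (Finset.mem_powersetCard.1 hI).2, Finset.card_univ]

variable [FiniteDimensional ℝ E]

/-- Almost surely exactly one of these events occurs, by the uniqueness of the basis, so their
indicators sum to `1`. -/
theorem sum_real_basisEvent_univ [Fintype ι] [DecidableEq ι]
    (hg : Measurable fun q : E × Z => p.g q.1 q.2) (hnd : ∀ x ∈ p.K, μ {v | p.g x v = 0} = 0) :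
    ∑ I : Finset ι with I.card ≤ Module.finrank ℝ E,
      (Measure.pi (fun _ : ι => μ)).real (p.basisEvent μ I Set.univ) = 1 := by
  have : SecondCountableTopology E := by
    have := FiniteDimensional.proper_real E
    infer_instance
  have h1 : ∀ I : Finset ι, (Measure.pi (fun _ : ι => μ)).real (p.basisEvent μ I Set.univ) =
      ∫ z, (p.basisEvent μ I Set.univ).indicator 1 z ∂Measure.pi (fun _ : ι => μ) := fun I =>
    (integral_indicator_one (measurableSet_basisEvent μ hg I MeasurableSet.univ)).symm
  simp_rw [h1]
  rw [← integral_finsetSum (f := fun I => (p.basisEvent μ I Set.univ).indicator 1) _ fun I _ => (integrable_indicator_iff (measurableSet_basisEvent μ hg I MeasurableSet.univ)).2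
      (integrable_const (1 : ℝ)).integrableOn]
  have h2 : ∀ᵐ z ∂Measure.pi (fun _ : ι => μ),
      ∑ I : Finset ι with I.card ≤ Module.finrank ℝ E,
        (p.basisEvent μ I Set.univ).indicator (1 : (ι → Z) → ℝ) z = 1 := by
    filter_upwards [ae_nondegenerate μ hg hnd] with z hz
    obtain ⟨B, hB, hBu⟩ := p.existsUnique_basis hz
    rw [Finset.sum_eq_single B]
    · exact Set.indicator_of_mem (by exact ⟨⟨hB.2.1, trivial⟩, hB.2.2⟩) _
    · intro C hC hCB
      refine Set.indicator_of_notMem (fun hzC => hCB (hBu C ⟨?_, hzC.1.1, hzC.2⟩)) _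
      exact (Finset.mem_filter.1 hC).2
    · exact fun h => (h (by simpa using hB.1)).elim
  rw [integral_congr_ae h2]
  simp

/-- The probability that the minimizer for `N` random scenarios satisfies a further random
constraint with probability less than `b` is at most the lower tail of a binomial distribution. -/
theorem real_pi_satProb_sol_lt_le
    (hg : Measurable fun q : E × Z => p.g q.1 q.2) (hnd : ∀ x ∈ p.K, μ {v | p.g x v = 0} = 0)
    (N : ℕ) {b : ℝ} (hb : 0 ≤ b) (hb1 : b < 1) :
    (Measure.pi (fun _ : Fin N => μ)).real {z | p.satProb μ (p.sol z Finset.univ) < b} ≤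
      ∑ i ∈ Finset.range (Module.finrank ℝ E),
        (N.choose i : ℝ) * (1 - b) ^ i * b ^ (N - i) := by
  have : SecondCountableTopology E := by
    have := FiniteDimensional.proper_real E
    infer_instance
  refine le_trans ?_ (sum_choose_mul_integral_le (Module.finrank ℝ E) (p.basisLaw μ)
    (ae_basisLaw_mem_Icc μ hg) (fun M => ?_) N hb hb1)
  · have h := sum_real_basisEvent (ι := Fin N) (p := p) μ hg (Module.finrank ℝ E)
      (measurableSet_Iio (a := b))
    rw [Fintype.card_fin] at h
    rw [← h]
    -- The minimizer for all scenarios is that of its basis, so the event is covered, up to a null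
    -- set, by the basis events with `t < b`.
    refine le_trans ?_ (measureReal_biUnion_finset_le _ _)
    refine ENNReal.toReal_mono (measure_ne_top _ _) (measure_mono_ae ?_)
    filter_upwards [ae_nondegenerate μ hg hnd] with z hz hzb
    obtain ⟨B, hB, -⟩ := p.existsUnique_basis hz
    have hsol : p.sol z Finset.univ = p.sol z B :=
      p.sol_eq_of_subset (Finset.subset_univ B) ⟨(p.sol_mem z B).1, fun i _ => by
        by_cases hi : i ∈ B
        · exact (p.sol_mem z B).2 i hi
        · exact hB.2.2 i hi⟩
    have hzb' : p.satProb μ (p.sol z B) < b := hsol ▸ hzb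
    exact Set.mem_biUnion (Finset.mem_coe.2 (Finset.mem_filter.2 ⟨Finset.mem_univ B, hB.1⟩))
      ⟨⟨hB.2.1, hzb'⟩, hB.2.2⟩
  -- The moment identity is needed for every number `M` of scenarios, not only for `N`; the measures
  -- `basisLaw` are the same for all `M`.
  · have h := sum_real_basisEvent (ι := Fin M) (p := p) μ hg (Module.finrank ℝ E)
      MeasurableSet.univ
    rw [sum_real_basisEvent_univ μ hg hnd, Fintype.card_fin] at h
    simpa using h.symm

end ConvexFamily

/-! ### Reduction of a general program to a regular one -/

/-- A convex function on a finite-dimensional convex set is continuous on each copy of the set shrunk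
towards a suitable (relative interior) point. -/
theorem exists_continuousOn_shrink {E : Type*} [NormedAddCommGroup E] [NormedSpace ℝ E]
    [FiniteDimensional ℝ E] {X : Set E} (hX : Convex ℝ X) (hne : X.Nonempty) :
    ∃ z ∈ X, ∀ h : E → ℝ, ConvexOn ℝ X h → ∀ t : ℝ, 0 < t → t ≤ 1 →
      ContinuousOn h ((fun y => (1 - t) • y + t • z) '' X) := by
  obtain ⟨z, hz⟩ := hne.intrinsicInterior hX
  obtain ⟨z', hz', rfl⟩ := hz
  have hzmem : z' ∈ ((↑) : affineSpan ℝ X → E) ⁻¹' X := interior_subset hz'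
  have hzX : (z' : E) ∈ X := hzmem
  -- `X` may have empty interior. Its preimage under an affine retraction `ψ` onto its affine span
  -- does not, and `h ∘ ψ` is convex there, hence continuous in the interior, where the shrunk
  -- copies lie.
  obtain ⟨P, hP⟩ := LinearMap.exists_leftInverse_of_injective
    (affineSpan ℝ X).direction.subtype (Submodule.ker_subtype _)
  have hPv : ∀ v : (affineSpan ℝ X).direction, P v = v := fun v => LinearMap.congr_fun hP v
  let L : E →ₗ[ℝ] E := (affineSpan ℝ X).direction.subtype ∘ₗ P
  let ψ : E →ᵃ[ℝ] E := L.toAffineMap + AffineMap.const ℝ E ((z' : E) - L z')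
  have hψ : ∀ x, ψ x = (P (x - z') : E) + z' := fun x => by
    simp [ψ, L]
    abel
  have hψmem : ∀ x, ψ x ∈ affineSpan ℝ X := fun x => by
    rw [hψ]
    exact AffineSubspace.vadd_mem_of_mem_direction (P (x - z')).2 z'.2
  have hψid : ∀ x ∈ X, ψ x = x := fun x hx => by
    have hd : x - z' ∈ (affineSpan ℝ X).direction :=
      AffineSubspace.vsub_mem_direction (subset_affineSpan ℝ X hx) z'.2
    rw [hψ, hPv ⟨x - z', hd⟩]
    simp
  have hψc : Continuous ψ := ψ.continuous_of_finiteDimensional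
  let θ : E → affineSpan ℝ X := fun x => ⟨ψ x, hψmem x⟩
  have hθc : Continuous θ := hψc.subtype_mk hψmem
  have hzint : (z' : E) ∈ interior (ψ ⁻¹' X) := by
    refine mem_interior.2 ⟨θ ⁻¹' interior ((↑) ⁻¹' X), fun x hx => ?_,
      isOpen_interior.preimage hθc, ?_⟩
    · have := interior_subset hx
      exact this
    · have : θ z' = z' := Subtype.ext (hψid _ hzX)
      rw [Set.mem_preimage, this]
      exact hz'
  refine ⟨z', hzX, fun h hh t ht0 ht1 => ?_⟩
  have hconv : ConvexOn ℝ (ψ ⁻¹' X) (h ∘ ψ) := hh.comp_affineMap ψ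
  have himg : (fun y => (1 - t) • y + t • (z' : E)) '' X ⊆ X := by
    rintro _ ⟨y, hy, rfl⟩
    exact hX hy hzX (by linarith) ht0.le (by ring)
  have hint : (fun y => (1 - t) • y + t • (z' : E)) '' X ⊆ interior (ψ ⁻¹' X) := by
    rintro _ ⟨y, hy, rfl⟩
    refine hconv.1.combo_self_interior_mem_interior ?_ hzint (by linarith) ht0 (by ring)
    rw [Set.mem_preimage, hψid y hy]
    exact hy
  refine (hconv.continuousOn_interior.mono hint).congr fun x hx => ?_
  rw [Function.comp_apply, hψid x (himg hx)]

/-- A strict Slater point can be moved so that all convex functions are continuous on the copies of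
the set shrunk towards it. -/
theorem exists_slater_continuousOn_shrink {E D : Type*} [NormedAddCommGroup E] [NormedSpace ℝ E]
    [FiniteDimensional ℝ E] {X : Set E} (hX : Convex ℝ X) {f : E → D → ℝ}
    (hf : ∀ d, ConvexOn ℝ X fun x => f x d) (hbdd : ∀ x ∈ X, ∃ M : ℝ, ∀ d, |f x d| ≤ M)
    {x₀ : E} (hx₀ : x₀ ∈ X) {m : ℝ} (hm : 0 < m) (hslater : ∀ d, f x₀ d ≤ -m) :
    ∃ x ∈ X, ∃ κ > 0, (∀ d, f x d ≤ -κ) ∧ ∀ t : ℝ, 0 < t → t ≤ 1 → ∀ d,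
      ContinuousOn (fun x => f x d) ((fun y => (1 - t) • y + t • x) '' X) := by
  obtain ⟨z, hz, hcont⟩ := exists_continuousOn_shrink hX ⟨x₀, hx₀⟩
  obtain ⟨M₀, hM₀⟩ := hbdd z hz
  obtain ⟨M, hM, hM0⟩ : ∃ M : ℝ, (∀ d, f z d ≤ M) ∧ 0 ≤ M :=
    ⟨max M₀ 0, fun d => ((le_abs_self _).trans (hM₀ d)).trans (le_max_left _ _), le_max_right _ _⟩
  obtain ⟨s, hs0, hs1, hs⟩ : ∃ s : ℝ, 0 < s ∧ s ≤ 1 / 2 ∧ (1 - s) * -m + s * M = -(m / 2) := by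
    refine ⟨m / (2 * (m + M)), by positivity, ?_, ?_⟩
    · rw [div_le_div_iff₀ (by positivity) (by norm_num)]
      linarith
    · have : m + M ≠ 0 := by positivity
      field_simp
      ring
  refine ⟨(1 - s) • x₀ + s • z, hX hx₀ hz (by linarith) hs0.le (by ring), m / 2, half_pos hm,
    fun d => ?_, fun t ht0 ht1 d => ?_⟩
  · have := (hf d).2 hx₀ hz (by linarith : 0 ≤ 1 - s) hs0.le (by ring)
    simp only [smul_eq_mul] at this
    rw [← hs]
    refine this.trans (add_le_add ?_ ?_)
    · exact mul_le_mul_of_nonneg_left (hslater d) (by linarith)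
    · exact mul_le_mul_of_nonneg_left (hM d) hs0.le
  · have hts : t * s ≤ 1 / 2 := by nlinarith
    -- Shrinking by `t` towards the new point lands inside the copy of `X` shrunk by `t * s` towards
    -- `z`: the share of `x₀` is absorbed into the point of `X`.
    refine (hcont _ (hf d) (t * s) (by positivity) (by linarith)).mono ?_
    rintro _ ⟨y, hy, rfl⟩
    have hpos : (1 - t * s) ≠ 0 := by linarith
    refine ⟨((1 - t) / (1 - t * s)) • y + (t * (1 - s) / (1 - t * s)) • x₀,
      hX hy hx₀ (div_nonneg (by linarith) (by linarith))
        (div_nonneg (mul_nonneg ht0.le (by linarith)) (by linarith)) ?_, ?_⟩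
    · field_simp
      ring
    · simp only [smul_add, smul_smul]
      rw [mul_div_cancel₀ _ hpos, mul_div_cancel₀ _ hpos, ← add_assoc]

/-- `f` is measurable only on `X × D`, while the measurability results for a `ConvexFamily` ask for
a constraint function measurable on the whole space. -/
theorem exists_measurable_extension {E D : Type*} [MeasurableSpace E] [MeasurableSpace D]
    {X : Set E} (hX : MeasurableSet X) {f : E → D → ℝ}
    (hf : Measurable fun q : X × D => f q.1 q.2) :
    ∃ F : E → D → ℝ, (Measurable fun q : E × D => F q.1 q.2) ∧ ∀ x ∈ X, ∀ d, F x d = f x d := by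
  have he : MeasurableEmbedding (Prod.map ((↑) : X → E) (id : D → D)) :=
    (MeasurableEmbedding.subtype_coe hX).prodMap MeasurableEmbedding.id
  refine ⟨fun x d => Function.extend (Prod.map ((↑) : X → E) (id : D → D))
    (fun q : X × D => f q.1 q.2) 0 (x, d), he.measurable_extend hf measurable_zero,
    fun x hx d => ?_⟩
  exact he.injective.extend_apply (fun q : X × D => f q.1 q.2) 0 (⟨x, hx⟩, d)

theorem strictConvexOn_inner_add_sq {E : Type*} [NormedAddCommGroup E] [InnerProductSpace ℝ E]
    {K : Set E} (hK : Convex ℝ K) (c : E) {τ : ℝ} (hτ : 0 < τ) :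
    StrictConvexOn ℝ K fun x => inner ℝ c x + τ * ‖x‖ ^ 2 := by
  refine StrongConvexOn.strictConvexOn (m := 2 * τ) (strongConvexOn_iff_convex.2 ?_) (by linarith)
  have : (fun x : E => inner ℝ c x + τ * ‖x‖ ^ 2 - 2 * τ / 2 * ‖x‖ ^ 2) = innerₗ E c := by
    ext x
    simp
  rw [this]
  exact (innerₗ E c).convexOn hK

/-- The family of programs with an additional random margin for each constraint. -/
def marginFamily {E D : Type*} [NormedAddCommGroup E] [InnerProductSpace ℝ E] {K : Set E}
    (hK : IsCompact K) (hKc : Convex ℝ K) {f : E → D → ℝ}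
    (hf : ∀ d, ConvexOn ℝ K fun x => f x d) (hfc : ∀ d, ContinuousOn (fun x => f x d) K)
    (c : E) {τ θ : ℝ} (hτ : 0 < τ) (hθ : 0 < θ) (hfeas : ∃ x ∈ K, ∀ d, f x d ≤ -θ) :
    ConvexFamily E (D × unitInterval) where
  K := K
  g x z := f x z.1 + θ * z.2
  φ x := inner ℝ c x + τ * ‖x‖ ^ 2
  isCompact := hK
  convexOn_g z := (hf z.1).add_const _
  continuousOn_g z := (hfc z.1).add continuousOn_const
  strictConvexOn_φ := strictConvexOn_inner_add_sq hKc c hτ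
  continuousOn_φ := by fun_prop
  exists_feasible := by
    obtain ⟨x, hx, h⟩ := hfeas
    exact ⟨x, hx, fun z => by nlinarith [h z.1, z.2.2.2]⟩

/-- A random margin makes constraints inactive with probability one. -/
theorem prod_volume_margin_eq_zero {D : Type*} [MeasurableSpace D] (P : Measure D) {u : D → ℝ}
    (hu : Measurable u) {θ : ℝ} (hθ : 0 < θ) :
    (P.prod (volume : Measure unitInterval)) {z | u z.1 + θ * (z.2 : ℝ) = 0} = 0 := by
  have hm : MeasurableSet {z : D × unitInterval | u z.1 + θ * (z.2 : ℝ) = 0} :=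
    measurableSet_eq_fun ((hu.comp measurable_fst).add
      ((measurable_subtype_coe.comp measurable_snd).const_mul θ)) measurable_const
  rw [Measure.measure_prod_null hm]
  refine Filter.Eventually.of_forall fun d => Set.Subsingleton.measure_zero (fun a ha b hb => ?_) _
  have ha' : u d + θ * (a : ℝ) = 0 := ha
  have hb' : u d + θ * (b : ℝ) = 0 := hb
  exact Subtype.ext (mul_left_cancel₀ hθ.ne' (by linarith))

/-- If all points of value less than `a` are violated with probability more than `ε`, then it is
unlikely that the scenario program has a feasible point of value less than `a' < a`. -/
theorem pi_le_of_exists_feasible_lt {n : ℕ} {D : Type*} [MeasurableSpace D]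
    (P : Measure D) [IsProbabilityMeasure P]
    {X : Set (EuclideanSpace ℝ (Fin n))} (hXcompact : IsCompact X) (hXconvex : Convex ℝ X)
    (c : EuclideanSpace ℝ (Fin n)) {f : EuclideanSpace ℝ (Fin n) → D → ℝ}
    (hf_meas : Measurable fun q : X × D => f q.1 q.2)
    (hf_convex : ∀ d, ConvexOn ℝ X fun x => f x d)
    (hf_bdd : ∀ x ∈ X, ∃ M : ℝ, ∀ d, |f x d| ≤ M)
    {x₀ : EuclideanSpace ℝ (Fin n)} (hx₀ : x₀ ∈ X) {m : ℝ} (hm : 0 < m)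
    (hslater : ∀ d, f x₀ d ≤ -m) {ε : ℝ} (hε0 : 0 < ε) (hε1 : ε ≤ 1) {a' a : ℝ} (haa : a' < a)
    (hV : ∀ x ∈ X, inner ℝ c x < a → P.real {d | f x d ≤ 0} < 1 - ε) (N : ℕ)
    {S : Set (Fin N → D)} (hS : MeasurableSet S)
    (hSa : ∀ d ∈ S, ∃ x ∈ scpFeasible X f d, inner ℝ c x < a') :
    Measure.pi (fun _ : Fin N => P) S ≤ ENNReal.ofReal
      (∑ i ∈ Finset.range n, (N.choose i : ℝ) * ε ^ i * (1 - ε) ^ (N - i)) := by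
  obtain ⟨F, hF, hFf⟩ := exists_measurable_extension hXcompact.measurableSet hf_meas
  obtain ⟨xb, hxb, κ, hκ, hxbκ, hcont⟩ :=
    exists_slater_continuousOn_shrink hXconvex hf_convex hf_bdd hx₀ hm hslater
  obtain ⟨R, hR, hXR⟩ := hXcompact.isBounded.exists_pos_norm_le
  set C : ℝ := ‖c‖ * R with hC
  have hC0 : 0 ≤ C := by positivity
  have hcC : ∀ x ∈ X, |inner ℝ c x| ≤ C := fun x hx =>
    (abs_real_inner_le_norm c x).trans (mul_le_mul_of_nonneg_left (hXR x hx) (norm_nonneg c))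
  have hΔ : 0 < a - a' := sub_pos.2 haa
  -- The gap `a - a'` is split in two: one half pays for shrinking by `η`, the other for the
  -- quadratic term with factor `τ`.
  obtain ⟨η, hη0, hη1, hηC⟩ : ∃ η : ℝ, 0 < η ∧ η ≤ 1 ∧ η * (2 * C) ≤ (a - a') / 2 := by
    refine ⟨(a - a') / (4 * C + (a - a')), by positivity, ?_, ?_⟩
    · rw [div_le_one (by positivity)]
      linarith
    · rw [div_mul_eq_mul_div, div_le_div_iff₀ (by positivity) (by norm_num)]
      nlinarith
  obtain ⟨τ, hτ0, hτ⟩ : ∃ τ : ℝ, 0 < τ ∧ τ * R ^ 2 = (a - a') / 2 :=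
    ⟨(a - a') / 2 / R ^ 2, by positivity, by field_simp⟩
  set K := (fun y => (1 - η) • y + η • xb) '' X with hKdef
  have hKX : K ⊆ X := by
    rintro _ ⟨y, hy, rfl⟩
    exact hXconvex hy hxb (by linarith) hη0.le (by ring)
  have hKcompact : IsCompact K := hXcompact.image (by fun_prop)
  have hKconvex : Convex ℝ K := by
    have := hXconvex.affinity (η • xb) (1 - η)
    simpa only [hKdef, add_comm] using this
  have hθ : 0 < η * κ := by positivity
  have hxbK : xb ∈ K := ⟨xb, hxb, by simp [← add_smul]⟩
  let p := marginFamily hKcompact hKconvex (f := F) (τ := τ) (θ := η * κ)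
    (fun d => ((hf_convex d).subset hKX hKconvex).congr fun x hx => (hFf x (hKX hx) d).symm)
    (fun d => (hcont η hη0 hη1 d).congr fun x hx => hFf x (hKX hx) d) c hτ0 hθ
    ⟨xb, hxbK, fun d => by rw [hFf xb hxb]; nlinarith [hxbκ d]⟩
  let μ : Measure (D × unitInterval) := P.prod volume
  have hg : Measurable fun q : EuclideanSpace ℝ (Fin n) × (D × unitInterval) => p.g q.1 q.2 := by
    change Measurable fun q : EuclideanSpace ℝ (Fin n) × (D × unitInterval) =>
      F q.1 q.2.1 + η * κ * (q.2.2 : ℝ)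
    have h1 : Measurable fun q : EuclideanSpace ℝ (Fin n) × (D × unitInterval) => F q.1 q.2.1 :=
      hF.comp (measurable_fst.prodMk (measurable_fst.comp measurable_snd))
    exact h1.add (((measurable_subtype_coe.comp measurable_snd).comp measurable_snd).const_mul _)
  have hFx : ∀ x, Measurable (F x) := fun x => hF.comp measurable_prodMk_left
  have hnd : ∀ x ∈ p.K, μ {v | p.g x v = 0} = 0 := fun x _ =>
    prod_volume_margin_eq_zero P (hFx x) hθ
  have hbound := ConvexFamily.real_pi_satProb_sol_lt_le μ hg hnd N (b := 1 - ε) (by linarith)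
    (by linarith)
  rw [finrank_euclideanSpace_fin, sub_sub_cancel] at hbound
  have hmp : MeasurePreserving (fun (z : Fin N → D × unitInterval) i => (z i).1)
      (Measure.pi fun _ => μ) (Measure.pi fun _ => P) :=
    measurePreserving_pi _ _ fun _ => measurePreserving_fst
  rw [← hmp.measure_preimage hS.nullMeasurableSet]
  refine le_trans (measure_mono fun z hz => ?_)
    ((ofReal_measureReal (measure_ne_top _ _)).ge.trans (ENNReal.ofReal_le_ofReal hbound))
  obtain ⟨y, hy, hya⟩ := hSa _ hz
  have hyK : (1 - η) • y + η • xb ∈ K := ⟨y, hy.1, rfl⟩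
  -- Shrinking towards `xb` gains slack `η * κ` in every constraint, which is the largest possible
  -- margin.
  have hyfeas : (1 - η) • y + η • xb ∈ p.feas z Finset.univ := by
    refine ⟨hyK, fun i _ => ?_⟩
    change F _ _ + η * κ * ((z i).2 : ℝ) ≤ 0
    rw [hFf _ (hKX hyK)]
    have h1 := (hf_convex (z i).1).2 hy.1 hxb (by linarith : 0 ≤ 1 - η) hη0.le (by ring)
    simp only [smul_eq_mul] at h1
    have h2 := mul_nonpos_of_nonneg_of_nonpos (by linarith : 0 ≤ 1 - η) (hy.2 i)
    have h3 := mul_le_mul_of_nonneg_left (hxbκ (z i).1) hη0.le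
    have h4 := mul_le_mul_of_nonneg_left (z i).2.2.2 hθ.le
    linarith
  set x := p.sol z Finset.univ with hxdef
  have hxX : x ∈ X := hKX (p.sol_mem z Finset.univ).1
  have hφ : inner ℝ c x + τ * ‖x‖ ^ 2 ≤ inner ℝ c ((1 - η) • y + η • xb) +
      τ * ‖(1 - η) • y + η • xb‖ ^ 2 := p.φ_sol_le hyfeas
  have hxa : inner ℝ c x < a := by
    have h1 : inner ℝ c ((1 - η) • y + η • xb) =
        inner ℝ c y + η * (inner ℝ c xb - inner ℝ c y) := by
      rw [inner_add_right, inner_smul_right, inner_smul_right]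
      ring
    have h2 : η * (inner ℝ c xb - inner ℝ c y) ≤ η * (2 * C) := by
      refine mul_le_mul_of_nonneg_left ?_ hη0.le
      linarith [(abs_le.1 (hcC xb hxb)).2, (abs_le.1 (hcC y hy.1)).1]
    have h3 : τ * ‖(1 - η) • y + η • xb‖ ^ 2 ≤ τ * R ^ 2 := by
      have := hXR _ (hKX hyK)
      gcongr
    have h4 : 0 ≤ τ * ‖x‖ ^ 2 := by positivity
    linarith
  -- The margin is nonnegative, so satisfying the constraint with margin is at most as likely as
  -- satisfying the original one.
  change p.satProb μ x < 1 - ε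
  refine lt_of_le_of_lt ?_ (hV x hxX hxa)
  have hmeas : MeasurableSet {d | F x d ≤ 0} := measurableSet_le (hFx x) measurable_const
  have hfst : μ.real (Prod.fst ⁻¹' {d | F x d ≤ 0}) = P.real {d | F x d ≤ 0} :=
    measurePreserving_fst.measureReal_preimage hmeas.nullMeasurableSet
  simp only [hFf x hxX] at hfst
  rw [← hfst]
  refine measureReal_mono fun v hv => ?_
  have hv' : F x v.1 + η * κ * (v.2 : ℝ) ≤ 0 := hv
  rw [hFf x hxX] at hv'
  have := mul_nonneg hθ.le v.2.2.1
  exact (by linarith : f x v.1 ≤ 0)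

/-! ### Monotonicity of the binomial tail in the sample size -/

/-- By Pascal's rule each new term is `ε * t (i - 1) + (1 - ε) * t i`; summed, the tail loses `ε`
times its last term. -/
theorem binomial_tail_succ_le (n N : ℕ) {ε : ℝ} (hε0 : 0 ≤ ε) (hε1 : ε ≤ 1) :
    ∑ i ∈ Finset.range n, ((N + 1).choose i : ℝ) * ε ^ i * (1 - ε) ^ (N + 1 - i) ≤
      ∑ i ∈ Finset.range n, (N.choose i : ℝ) * ε ^ i * (1 - ε) ^ (N - i) := by
  let t : ℕ → ℝ := fun i => (N.choose i : ℝ) * ε ^ i * (1 - ε) ^ (N - i)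
  have ht : ∀ i, 0 ≤ t i := fun i => by
    have : 0 ≤ 1 - ε := by linarith
    positivity
  have hs : ∀ i, ((N + 1).choose (i + 1) : ℝ) * ε ^ (i + 1) * (1 - ε) ^ (N + 1 - (i + 1)) =
      ε * t i + (1 - ε) * t (i + 1) := fun i => by
    simp only [t, Nat.choose_succ_succ, Nat.cast_add, Nat.add_sub_add_right]
    -- The exponent `N - (i + 1)` is truncated when `i ≥ N`, but then the binomial coefficient
    -- vanishes.
    rcases Nat.lt_or_ge i N with h | h
    · have : N - i = N - (i + 1) + 1 := by omega
      rw [this]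
      ring
    · rw [Nat.choose_eq_zero_of_lt (by omega : N < i + 1)]
      simp
      ring
  rcases n with _ | n
  · simp
  · rw [Finset.sum_range_succ', Finset.sum_congr rfl fun i _ => hs i, Finset.sum_add_distrib,
      ← Finset.mul_sum, ← Finset.mul_sum]
    change _ ≤ ∑ i ∈ Finset.range (n + 1), t i
    have h0 : ((N + 1).choose 0 : ℝ) * ε ^ 0 * (1 - ε) ^ (N + 1 - 0) = (1 - ε) * t 0 := by
      simp [t]
      ring
    have h1 : ∑ i ∈ Finset.range n, t i ≤ ∑ i ∈ Finset.range (n + 1), t i :=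
      Finset.sum_le_sum_of_subset_of_nonneg (by simp) fun i _ _ => ht i
    have h2 := Finset.sum_range_succ' t n
    rw [h0]
    nlinarith

theorem binomial_tail_le_of_sampleSize_le {n N : ℕ} {ε β : ℝ} (hε0 : 0 ≤ ε) (hε1 : ε ≤ 1)
    (hN : sampleSize n ε β ≤ N) :
    ∑ i ∈ Finset.range n, (N.choose i : ℝ) * ε ^ i * (1 - ε) ^ (N - i) ≤ β := by
  obtain ⟨M, hM, hMN⟩ : ∃ M : ℕ, ∑ i ∈ Finset.range n, (M.choose i : ℝ) * ε ^ i *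
      (1 - ε) ^ (M - i) ≤ β ∧ M ≤ N := by
    by_contra! h
    have : ((N + 1 : ℕ) : ℕ∞) ≤ sampleSize n ε β :=
      le_iInf₂ fun M hM => Nat.cast_le.2 (h M hM)
    have := Nat.cast_le.1 (this.trans hN)
    omega
  refine le_trans ?_ hM
  exact antitone_nat_of_succ_le
    (f := fun N : ℕ => ∑ i ∈ Finset.range n, (N.choose i : ℝ) * ε ^ i * (1 - ε) ^ (N - i))
    (fun N => binomial_tail_succ_le n N hε0 hε1) hMN

/-! ### From violation probability to optimal values -/

section

variable {n : ℕ} {D : Type*} {X : Set (EuclideanSpace ℝ (Fin n))} {c : EuclideanSpace ℝ (Fin n)}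
  {f : EuclideanSpace ℝ (Fin n) → D → ℝ}

theorem bddBelow_inner_image {K : Set (EuclideanSpace ℝ (Fin n))} (hX : IsCompact X) (hK : K ⊆ X) :
    BddBelow ((fun x => (inner ℝ c x : ℝ)) '' K) :=
  (hX.bddBelow_image (f := fun x => (inner ℝ c x : ℝ)) (by fun_prop)).mono (Set.image_mono hK)

theorem IsOptimizer.optVal_eq {K : Set (EuclideanSpace ℝ (Fin n))} {x : EuclideanSpace ℝ (Fin n)}
    (h : IsOptimizer c K x) : optVal c K = inner ℝ c x := by
  refine IsLeast.csInf_eq ⟨⟨x, h.1, rfl⟩, ?_⟩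
  rintro _ ⟨y, hy, rfl⟩
  exact h.2 y hy

theorem optVal_rcp_le (hX : IsCompact X) {x : EuclideanSpace ℝ (Fin n)}
    (hx : x ∈ rcpFeasible X f) : optVal c (rcpFeasible X f) ≤ inner ℝ c x :=
  csInf_le (bddBelow_inner_image hX fun _ h => h.1) ⟨x, hx, rfl⟩

/-- Moving a point towards the Slater point restores feasibility, at a cost proportional to the
worst-case violation. -/
theorem optVal_rcp_le_add (hX : IsCompact X) (hXc : Convex ℝ X)
    (hf_convex : ∀ d, ConvexOn ℝ X fun x => f x d) (hf_bdd : ∀ x ∈ X, ∃ M : ℝ, ∀ d, |f x d| ≤ M)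
    {x₀ x : EuclideanSpace ℝ (Fin n)} (hx₀ : x₀ ∈ X) (hslater : (⨆ d, f x₀ d) < 0) (hx : x ∈ X)
    (hpos : 0 ≤ ⨆ d, f x d) :
    optVal c (rcpFeasible X f) ≤ inner ℝ c x + slaterConst c X f x₀ * ⨆ d, f x d := by
  have hle : ∀ y ∈ X, ∀ d, f y d ≤ ⨆ d, f y d := fun y hy d => by
    obtain ⟨M, hM⟩ := hf_bdd y hy
    exact le_ciSup (f := fun d => f y d) ⟨M, by rintro _ ⟨d, rfl⟩; exact (abs_le.1 (hM d)).2⟩ d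
  have h0 := hle x₀ hx₀
  have h1 := hle x hx
  rw [slaterConst]
  generalize (⨆ d, f x d) = s at *
  generalize (⨆ d, f x₀ d) = s₀ at *
  set m := sInf ((fun x => (inner ℝ c x : ℝ)) '' X) with hm
  have hmle : ∀ y ∈ X, m ≤ inner ℝ c y := fun y hy =>
    csInf_le (bddBelow_inner_image hX subset_rfl) ⟨y, hy, rfl⟩
  have hden : 0 < s - s₀ := by linarith
  -- The weight at which the interpolation between the worst-case values `s` at `x` and `s₀` at the
  -- Slater point reaches `0`.
  set r := s / (s - s₀) with hr
  have hr0 : 0 ≤ r := div_nonneg hpos hden.le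
  have hr1 : r ≤ 1 := by rw [hr, div_le_one hden]; linarith
  have hrs : (1 - r) * s + r * s₀ = 0 := by
    rw [hr]
    field_simp
    ring
  have hy : (1 - r) • x + r • x₀ ∈ rcpFeasible X f := by
    refine ⟨hXc hx hx₀ (by linarith) hr0 (by ring), fun d => ?_⟩
    have := (hf_convex d).2 hx hx₀ (by linarith : 0 ≤ 1 - r) hr0 (by ring)
    simp only [smul_eq_mul] at this
    have h2 := mul_le_mul_of_nonneg_left (h1 d) (by linarith : 0 ≤ 1 - r)
    have h3 := mul_le_mul_of_nonneg_left (h0 d) hr0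
    linarith
  refine (optVal_rcp_le hX hy).trans ?_
  rw [inner_add_right, inner_smul_right, inner_smul_right]
  have hrle : r ≤ s / -s₀ := div_le_div_of_nonneg_left hpos (by linarith) (by linarith)
  have h4 : r * (inner ℝ c x₀ - inner ℝ c x) ≤ r * (inner ℝ c x₀ - m) :=
    mul_le_mul_of_nonneg_left (by linarith [hmle x hx]) hr0
  have h5 : r * (inner ℝ c x₀ - m) ≤ s / -s₀ * (inner ℝ c x₀ - m) :=
    mul_le_mul_of_nonneg_right hrle (by linarith [hmle x₀ hx₀])
  have h6 : (m - inner ℝ c x₀) / s₀ * s = s / -s₀ * (inner ℝ c x₀ - m) := by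
    field_simp
    ring
  linarith

theorem slaterConst_nonneg (hX : IsCompact X) {x₀ : EuclideanSpace ℝ (Fin n)} (hx₀ : x₀ ∈ X)
    (hslater : (⨆ d, f x₀ d) < 0) : 0 ≤ slaterConst c X f x₀ :=
  div_nonneg_of_nonpos (sub_nonpos.2 (csInf_le (bddBelow_inner_image hX subset_rfl) ⟨x₀, hx₀, rfl⟩))
    hslater.le

variable [MeasurableSpace D] {P : Measure D}

/-- A point violated with probability at most `ε` is at most `L * h ε` better than the robust
optimum. -/
theorem optVal_rcp_le_add_of_measure_le (hX : IsCompact X) (hXc : Convex ℝ X)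
    (hf_convex : ∀ d, ConvexOn ℝ X fun x => f x d) (hf_bdd : ∀ x ∈ X, ∃ M : ℝ, ∀ d, |f x d| ≤ M)
    {x₀ x : EuclideanSpace ℝ (Fin n)} (hx₀ : x₀ ∈ X) (hslater : (⨆ d, f x₀ d) < 0) (hx : x ∈ X)
    {h : Set.Icc (0 : ℝ) 1 → ℝ≥0∞} (h_ulb : IsULB P X f h) {ε : Set.Icc (0 : ℝ) 1}
    (hfin : ENNReal.ofReal (slaterConst c X f x₀) * h ε ≠ ∞)
    (hV : P {d | 0 < f x d} ≤ ENNReal.ofReal ε) :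
    optVal c (rcpFeasible X f) ≤
      inner ℝ c x + (ENNReal.ofReal (slaterConst c X f x₀) * h ε).toReal := by
  have hL := slaterConst_nonneg (c := c) hX hx₀ hslater
  rcases le_or_gt (⨆ d, f x d) 0 with hs | hs
  · obtain ⟨M, hM⟩ := hf_bdd x hx
    have hxr : x ∈ rcpFeasible X f := ⟨hx, fun d => le_trans
      (le_ciSup (f := fun d => f x d) ⟨M, by rintro _ ⟨d, rfl⟩; exact (abs_le.1 (hM d)).2⟩ d) hs⟩
    exact (optVal_rcp_le hX hxr).trans (le_add_of_nonneg_right ENNReal.toReal_nonneg)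
  · refine (optVal_rcp_le_add hX hXc hf_convex hf_bdd hx₀ hslater hx hs.le).trans
      (add_le_add le_rfl ?_)
    -- For this `δ` the threshold `sup f(x, ·) - δ` is `0`, so the tail probability at `x` is the
    -- violation probability.
    let δ : ℝ≥0 := ⟨⨆ d, f x d, hs.le⟩
    have hδ : (δ : ℝ≥0∞) ≤ h ε := by
      refine le_trans ?_ (h_ulb ε)
      refine le_iSup₂ (f := fun (δ : ℝ≥0) (_ : δ ∈ {δ : ℝ≥0 |
        (⨅ x ∈ X, tailProb P f x δ) ≤ ENNReal.ofReal (ε : ℝ)}) => (δ : ℝ≥0∞)) δ ?_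
      change (⨅ x ∈ X, tailProb P f x δ) ≤ ENNReal.ofReal (ε : ℝ)
      refine (iInf₂_le x hx).trans ?_
      have : tailProb P f x δ = P {d | 0 < f x d} := by
        change P {d | (⨆ v, f x v) - (⨆ v, f x v) < f x d} = _
        rw [sub_self]
      rw [this]
      exact hV
    rw [← ENNReal.ofReal_le_iff_le_toReal hfin, ENNReal.ofReal_mul hL]
    refine mul_le_mul_right ?_ _
    refine le_trans (le_of_eq ?_) hδ
    exact ENNReal.ofReal_eq_coe_nnreal hs.le

end

end ScenarioProgram

/-! ### The confidence interval -/

open ScenarioProgram in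
theorem theorem3p5
    {n : ℕ} {D : Type*} [MetricSpace D] [MeasurableSpace D] [BorelSpace D]
    (P : MeasureTheory.Measure D) [MeasureTheory.IsProbabilityMeasure P]
    (X : Set (EuclideanSpace ℝ (Fin n))) (hXcompact : IsCompact X) (hXconvex : Convex ℝ X)
    (c : EuclideanSpace ℝ (Fin n))
    (f : EuclideanSpace ℝ (Fin n) → D → ℝ)
    (hf_meas : Measurable (fun q : X × D => f q.1 q.2))
    (hf_convex : ∀ d : D, ConvexOn ℝ X (fun x => f x d))
    (hf_bdd : ∀ x ∈ X, ∃ M : ℝ, ∀ d : D, |f x d| ≤ M)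
    -- the optimizer of the scenario program generates a measurable map
    (h_opt : ∀ N : ℕ, ∃ xstar : (Fin N → D) → EuclideanSpace ℝ (Fin n), Measurable xstar ∧
      ∀ d : Fin N → D,
        ScenarioProgram.IsOptimizer c (ScenarioProgram.scpFeasible X f d) (xstar d))
    -- Slater point
    (x₀ : EuclideanSpace ℝ (Fin n)) (hx₀ : x₀ ∈ X) (h_slater : (⨆ d, f x₀ d) < 0)
    (h : Set.Icc (0 : ℝ) 1 → ℝ≥0∞) (h_ulb : ScenarioProgram.IsULB P X f h)
    (ε β : Set.Icc (0 : ℝ) 1) (N : ℕ)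
    (hN : ScenarioProgram.sampleSize n (ε : ℝ) (β : ℝ) ≤ (N : ℕ∞)) :
    ENNReal.ofReal (1 - (β : ℝ)) ≤
      MeasureTheory.Measure.pi (fun _ : Fin N => P)
        {d : Fin N → D |
          ScenarioProgram.optVal c (ScenarioProgram.rcpFeasible X f) -
            ScenarioProgram.optVal c (ScenarioProgram.scpFeasible X f d) ∈
          Set.Icc (0 : ℝ)
            (ScenarioProgram.intervalLength c X
              (ScenarioProgram.slaterConst c X f x₀) (h ε))} := by
  have hβ := binomial_tail_le_of_sampleSize_le ε.2.1 ε.2.2 hN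
  obtain ⟨xs, hxs_meas, hxs⟩ := h_opt N
  have hJN : ∀ d : Fin N → D, optVal c (scpFeasible X f d) = inner ℝ c (xs d) :=
    fun d => (hxs d).optVal_eq
  have hx₀f : ∀ d, f x₀ d ≤ ⨆ d, f x₀ d := fun d => by
    obtain ⟨M, hM⟩ := hf_bdd x₀ hx₀
    exact le_ciSup (f := fun d => f x₀ d) ⟨M, by rintro _ ⟨d, rfl⟩; exact (abs_le.1 (hM d)).2⟩ d
  have hx₀r : x₀ ∈ rcpFeasible X f := ⟨hx₀, fun d => (hx₀f d).trans h_slater.le⟩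
  set J := optVal c (rcpFeasible X f) with hJ
  have hJN_le : ∀ d : Fin N → D, inner ℝ c (xs d) ≤ J := fun d => by
    refine le_csInf ⟨_, x₀, hx₀r, rfl⟩ ?_
    rintro _ ⟨y, hy, rfl⟩
    exact (hxs d).2 y ⟨hy.1, fun i => hy.2 (d i)⟩
  set A := ENNReal.ofReal (slaterConst c X f x₀) * h ε with hA
  set B := ENNReal.ofReal (sSup ((fun x => (inner ℝ c x : ℝ)) '' X) -
    sInf ((fun x => (inner ℝ c x : ℝ)) '' X)) with hB
  have hI : intervalLength c X (slaterConst c X f x₀) (h ε) = (min A B).toReal := rfl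
  simp only [hJN, hI, Set.mem_Icc, sub_nonneg, hJN_le, true_and]
  -- If the range of the objective is the smaller bound, the event is certain. Otherwise `A` is
  -- finite and can be read as a real number.
  rcases lt_or_ge B A with hBA | hAB
  · have huniv : {d : Fin N → D | J - inner ℝ c (xs d) ≤ (min A B).toReal} = Set.univ := by
      refine Set.eq_univ_of_forall fun d => ?_
      have h1 : J ≤ sSup ((fun x => (inner ℝ c x : ℝ)) '' X) :=
        (optVal_rcp_le hXcompact hx₀r).trans (le_csSup
          (hXcompact.bddAbove_image (f := fun x => (inner ℝ c x : ℝ)) (by fun_prop))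
          ⟨x₀, hx₀, rfl⟩)
      have h2 : sInf ((fun x => (inner ℝ c x : ℝ)) '' X) ≤ inner ℝ c (xs d) :=
        csInf_le (bddBelow_inner_image hXcompact subset_rfl) ⟨xs d, (hxs d).1.1, rfl⟩
      rw [Set.mem_ofPred_eq, min_eq_right hBA.le, hB]
      exact (by linarith : J - inner ℝ c (xs d) ≤ _).trans (le_max_left _ _)
    rw [huniv, measure_univ, ← ENNReal.ofReal_one]
    exact ENNReal.ofReal_le_ofReal (by linarith [β.2.1])
  have hAfin : A ≠ ∞ := ne_top_of_le_ne_top ENNReal.ofReal_ne_top hAB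
  rw [min_eq_left hAB]
  set a := J - A.toReal with ha
  have haJ : a ≤ J := sub_le_self _ ENNReal.toReal_nonneg
  have hV : ∀ x ∈ X, inner ℝ c x < a → P.real {d | f x d ≤ 0} < 1 - ε := fun x hx hxa => by
    by_contra! hle
    have hm : MeasurableSet {d | f x d ≤ 0} := measurableSet_le
      (hf_meas.comp (measurable_prodMk_left (x := (⟨x, hx⟩ : X)))) measurable_const
    have hcompl : {d | 0 < f x d} = {d | f x d ≤ 0}ᶜ := by
      ext d
      simp
    have hreal : P.real {d | 0 < f x d} ≤ ε := by
      rw [hcompl, probReal_compl_eq_one_sub hm]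
      linarith
    have := optVal_rcp_le_add_of_measure_le (c := c) hXcompact hXconvex hf_convex hf_bdd hx₀
      h_slater hx h_ulb hAfin
      ((ofReal_measureReal (measure_ne_top _ _)).ge.trans (ENNReal.ofReal_le_ofReal hreal))
    linarith
  have hkey : ∀ a' < a, Measure.pi (fun _ : Fin N => P) {d | inner ℝ c (xs d) < a'} ≤
      ENNReal.ofReal β := fun a' ha' => by
    have hS : MeasurableSet {d : Fin N → D | inner ℝ c (xs d) < a'} :=
      measurableSet_lt (measurable_const.inner hxs_meas) measurable_const
    -- The tail estimate needs `1 - ε < 1`. At `ε = 0` either the space is a single point, or the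
    -- tail equals `1` through its term `i = 0` and forces `β ≥ 1`.
    rcases eq_or_lt_of_le ε.2.1 with hε | hε
    · rcases n with _ | n
      · have : {d : Fin N → D | inner ℝ c (xs d) < a'} = ∅ := by
          ext d
          have h1 := optVal_rcp_le (c := c) hXcompact hx₀r
          rw [Subsingleton.elim x₀ (xs d)] at h1
          simp only [Set.mem_ofPred_eq, Set.mem_empty_iff_false, iff_false, not_lt]
          linarith
        rw [this, measure_empty]
        exact zero_le
      · have h1 : (1 : ℝ) ≤ β := by
          rw [← hε, Finset.sum_range_succ'] at hβ
          simpa using hβ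
        exact prob_le_one.trans (by simpa using ENNReal.ofReal_le_ofReal h1)
    · exact (pi_le_of_exists_feasible_lt P hXcompact hXconvex c hf_meas hf_convex hf_bdd hx₀
        (neg_pos.2 h_slater) (fun d => by simpa using hx₀f d) hε ε.2.2 ha' hV N hS
        fun d hd => ⟨xs d, (hxs d).1, hd⟩).trans (ENNReal.ofReal_le_ofReal hβ)
  -- The regularization costs a strict gap `a' < a`; continuity from below of the measure closes it.
  have hlim : Measure.pi (fun _ : Fin N => P) {d | inner ℝ c (xs d) < a} ≤ ENNReal.ofReal β := by
    have hU : {d : Fin N → D | inner ℝ c (xs d) < a} =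
        ⋃ k : ℕ, {d | inner ℝ c (xs d) < a - 1 / ((k : ℝ) + 1)} := by
      ext d
      simp only [Set.mem_ofPred_eq, Set.mem_iUnion]
      constructor
      · intro hd
        obtain ⟨k, hk⟩ := exists_nat_one_div_lt (sub_pos.2 hd)
        exact ⟨k, by linarith⟩
      · rintro ⟨k, hk⟩
        have : 0 < 1 / ((k : ℝ) + 1) := by positivity
        linarith
    rw [hU, Monotone.measure_iUnion]
    · exact iSup_le fun k => hkey _ (sub_lt_self _ (by positivity))
    · intro k l hkl d hd
      have hd' : inner ℝ c (xs d) < a - 1 / ((k : ℝ) + 1) := hd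
      have := Nat.one_div_le_one_div (α := ℝ) hkl
      exact (by linarith : inner ℝ c (xs d) < a - 1 / ((l : ℝ) + 1))
  have hG : {d : Fin N → D | J - inner ℝ c (xs d) ≤ A.toReal}ᶜ =
      {d | inner ℝ c (xs d) < a} := by
    ext d
    simp only [Set.mem_compl_iff, Set.mem_ofPred_eq, not_le]
    constructor <;> intro h <;> linarith
  have hone : (1 : ℝ≥0∞) ≤ Measure.pi (fun _ : Fin N => P)
      {d : Fin N → D | J - inner ℝ c (xs d) ≤ A.toReal} + ENNReal.ofReal β := by
    refine le_trans ?_ (add_le_add le_rfl (hG ▸ hlim))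
    rw [← measure_univ (μ := Measure.pi fun _ : Fin N => P), ← Set.union_compl_self
      {d : Fin N → D | J - inner ℝ c (xs d) ≤ A.toReal}]
    exact measure_union_le _ _
  rw [ENNReal.ofReal_sub _ β.2.1, ENNReal.ofReal_one]
  exact tsub_le_iff_right.2 hone
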